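/- Let $n\ge 1$ and $m\ge 0$ be integers and consider near the origin the smooth slow-fast Liénard family $$\dot x=y-x^{2n},\qquad \dot y=\varepsilon\,(a+F(x,\rho))+O(\varepsilon^2),$$ where $\varepsilon\ge 0$, $a\in\mathbb R$ and $\rho\in\mathbb R^m$ are close to $0$, the functions $F(x,\rho)$ and $O(\varepsilon^2)$ are $C^\infty$, and $F(x,\rho)=-x^{2n-1}+O(x^{2n})$. Let $f_i$ be the Taylor coefficients of $x\mapsto F(x,0)$ at $x=0$, and suppose that the contact point $(0,0)$ has finite codimension $k$, i.e. $k$ is the smallest integer $\ge n$ with $f_{2k}\neq 0$. For small $y>0$ put $\omega(y)=y^{1/(2n)}$, $\alpha(y)=-y^{1/(2n)}$ and $$J_-(y)=\int_{\omega(y)}^0\frac{-(2nx^{2n-1})^2}{F(x,0)}\,dx,\qquad J_+(y)=\int_{\alpha(y)}^0\frac{-(2nx^{2n-1})^2}{F(x,0)}\,dx .$$ Then there is $\delta>0$ such that these integrals are well defined for all $y\in(0,\delta)$, $J_--J_+$ has a constant nonzero sign on $(0,\delta)$, and for every $y_0\in(0,\delta)$ there is exactly one sequence $(y_l)_{l\ge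 0}$ in $(0,\delta)$ starting at $y_0$ with $$J_-(y_{l+1})=J_+(y_l)\ \text{ for all } l\ge 0\quad\text{if } J_--J_+<0 \text{ on }(0,\delta),$$ $$J_-(y_l)=J_+(y_{l+1})\ \text{ for all } l\ge 0\quad\text{if } J_--J_+>0 \text{ on }(0,\delta).$$ This sequence decreases strictly to $0$. Write $\mathcal O=\{y_0,y_1,\dots\}$ and $\mathcal U=\bigcup_{l\ge 0}\,]\alpha(y_l),\omega(y_l)[\times\{y_l\}\subset\mathbb R^2$, and write $a_l\simeq b_l$ if there are constants $0<A<B$ with $A\le a_l/b_l\le B$ for all $l\ge 1$. Then: 1. $y_l\simeq l^{-\frac{2n}{2(k-n)+1}}$ and $y_l-y_{l+1}\simeq l^{-\frac{2k+1}{2(k-n)+1}}$. 2. The box dimension of $\mathcal O$ exists and $\dim_B\mathcal O=\frac{2(k-n)+1}{2k+1}\in\,]0,1[$. 3. $\mathcal U$ is a geometric $(\delta_1,\delta_2)$-chirp with $\delta_1=\frac1{2n}$ and $\delta_2=\frac{2(k-n)+1}{2n}$. 4. $\overline{\dim}_B\,\mathcal U=\frac{4k-2n+1}{2k+1}\in[1,2[$.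 In particular, the two dimensions do not depend on $y_0$. Here the upper box dimension of a bounded set $A\subset\mathbb R^N$ is the infimum of the $s\ge 0$ with $\limsup_{\epsilon\to0^+}|A_\epsilon|/\epsilon^{N-s}=0$, where $|A_\epsilon|$ is the Lebesgue measure of the open $\epsilon$-neighbourhood of $A$; the lower box dimension is defined with $\liminf$ instead, and the box dimension exists if the two agree. A geometric $(\delta_1,\delta_2)$-chirp ($\delta_1,\delta_2>0$) is a set of the form $\bigcup_{l\ge0}\,]a_l,b_l[\times\{t_l\}$ with $a_l\le 0\le b_l$, $a_l<b_l$, $t_l>0$ strictly decreasing to $0$, $t_l\simeq l^{-1/\delta_2}$, $t_l-t_{l+1}\simeq l^{-1/\delta_2-1}$ and $b_l-a_l\simeq l^{-\delta_1/\delta_2}$. -/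

import Mathlib

open Set Filter Topology MeasureTheory Asymptotics
open scoped ContDiff

noncomputable section BoxDimension

variable {E : Type*} [NormedAddCommGroup E] [NormedSpace ℝ E] [MeasureSpace E]

/-- The ratio `|A_ε| / ε ^ (N - s)`, where `A_ε` is the open `ε`-neighbourhood of `A`, `|·|` is
the volume and `N` is the dimension of the ambient space. -/
def minkowskiRatio (s : ℝ) (A : Set E) (ε : ℝ) : ENNReal :=
  volume (Metric.thickening ε A) / ENNReal.ofReal (ε ^ ((Module.finrank ℝ E : ℝ) - s))

/-- The lower `s`-dimensional Minkowski content. -/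
def lowerMinkowskiContent (s : ℝ) (A : Set E) : ENNReal :=
  liminf (minkowskiRatio s A) (𝓝[>] (0 : ℝ))

/-- The upper `s`-dimensional Minkowski content. -/
def upperMinkowskiContent (s : ℝ) (A : Set E) : ENNReal :=
  limsup (minkowskiRatio s A) (𝓝[>] (0 : ℝ))

/-- The lower box dimension of a bounded set. -/
def lowerBoxDim (A : Set E) : ℝ := sInf {s : ℝ | 0 ≤ s ∧ lowerMinkowskiContent s A = 0}

/-- The upper box dimension of a bounded set. -/
def upperBoxDim (A : Set E) : ℝ := sInf {s : ℝ | 0 ≤ s ∧ upperMinkowskiContent s A = 0}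

/-- The bounded set `A` has box dimension `d`: the lower and the upper box dimension are `d`. -/
def HasBoxDim (A : Set E) (d : ℝ) : Prop := lowerBoxDim A = d ∧ upperBoxDim A = d

end BoxDimension

/-- `a_l ≃ b_l`: the ratios lie between two positive constants. The index `l = 0` is left out
since the comparison sequences are negative powers of `l`. -/
def SeqComparable (a b : ℕ → ℝ) : Prop :=
  ∃ A B : ℝ, 0 < A ∧ A < B ∧ ∀ l : ℕ, 1 ≤ l → a l / b l ∈ Icc A B

/-- The union of the horizontal open intervals `]a_l, b_l[ × {y_l}` in the plane. -/
def horizontalIntervals (a b y : ℕ → ℝ) : Set (EuclideanSpace ℝ (Fin 2)) :=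
  ⋃ l : ℕ, {p | p 0 ∈ Ioo (a l) (b l) ∧ p 1 = y l}

/-- A geometric `(δ₁, δ₂)`-chirp: a union of horizontal open intervals, starting from or crossing
the vertical axis, at positive levels `y_l` decreasing to `0`, where
(up to `≃`) the levels, the gaps between them, and the lengths of the intervals are those of the
model chirp with levels `l ^ (-1/δ₂)` and lengths `l ^ (-δ₁/δ₂)`. -/
def IsGeometricChirp (δ₁ δ₂ : ℝ) (U : Set (EuclideanSpace ℝ (Fin 2))) : Prop :=
  0 < δ₁ ∧ 0 < δ₂ ∧ ∃ a b y : ℕ → ℝ,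
    U = horizontalIntervals a b y ∧
    (∀ l, a l ≤ 0 ∧ 0 ≤ b l ∧ a l < b l) ∧
    (∀ l, 0 < y l) ∧ StrictAnti y ∧ Tendsto y atTop (𝓝 0) ∧
    SeqComparable y (fun l => (l : ℝ) ^ (-(1 / δ₂))) ∧
    SeqComparable (fun l => y l - y (l + 1)) (fun l => (l : ℝ) ^ (-(1 / δ₂ + 1))) ∧
    SeqComparable (fun l => b l - a l) (fun l => (l : ℝ) ^ (-(δ₁ / δ₂)))

/-- The data of a smooth slow-fast Liénard family
`x' = y - x ^ (2n)`, `y' = ε (a + F (x, ρ)) + O(ε²)`, with `ε ≥ 0`,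
`F (x, ρ) = - x ^ (2n-1) + O(x ^ (2n))` and `ρ ∈ ℝ^m`, all near the origin.
The `O(ε²)` term `R` is a function of `(x, y, ε, a, ρ)`. -/
structure LienardFamily (n m : ℕ) where
  F : ℝ × EuclideanSpace ℝ (Fin m) → ℝ
  R : ℝ × ℝ × ℝ × ℝ × EuclideanSpace ℝ (Fin m) → ℝ
  smooth_F : ∀ᶠ p in 𝓝 0, ContDiffAt ℝ ∞ F p
  leading_F : (fun p => F p + p.1 ^ (2 * n - 1)) =O[𝓝 0] (fun p => p.1 ^ (2 * n))
  smooth_R : ∀ᶠ p in 𝓝[{p | 0 ≤ p.2.2.1}] 0, ContDiffWithinAt ℝ ∞ R {p | 0 ≤ p.2.2.1} p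
  order_R : R =O[𝓝[{p | 0 ≤ p.2.2.1}] 0] (fun p => p.2.2.1 ^ 2)

namespace LienardFamily

noncomputable section

variable {n m : ℕ} (X : LienardFamily n m)

/-- The vector field of the family at the parameters `(ε, a, ρ)`. -/
def vectorField (ε a : ℝ) (ρ : EuclideanSpace ℝ (Fin m)) (p : EuclideanSpace ℝ (Fin 2)) :
    EuclideanSpace ℝ (Fin 2) :=
  !₂[p 1 - p 0 ^ (2 * n), ε * (a + X.F (p 0, ρ)) + X.R (p 0, p 1, ε, a, ρ)]

/-- The Taylor coefficient `f_i(ρ)` of `x ↦ F (x, ρ)` at `x = 0`. -/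
def taylorCoeff (i : ℕ) (ρ : EuclideanSpace ℝ (Fin m)) : ℝ :=
  iteratedDeriv i (fun x : ℝ => X.F (x, ρ)) 0 / (i.factorial : ℝ)

/-- The contact point has finite codimension `k`: `k` is the smallest integer `k ≥ n` with
`f_{2k}(0) ≠ 0`. -/
def HasCodimension (k : ℕ) : Prop :=
  IsLeast {j : ℕ | n ≤ j ∧ X.taylorCoeff (2 * j) 0 ≠ 0} k

/-- The abscissa of the `ω`-limit on the attracting branch `x > 0` of the curve `y = x ^ (2n)` of
the fast horizontal orbit at height `y`. -/
def omegaPt (n : ℕ) (y : ℝ) : ℝ := y ^ (1 / (2 * (n : ℝ)))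

/-- The abscissa of the `α`-limit, on the repelling branch `x < 0`. -/
def alphaPt (n : ℕ) (y : ℝ) : ℝ := -(y ^ (1 / (2 * (n : ℝ))))

/-- The integrand of the slow divergence integrals: the divergence `-2n x ^ (2n-1)` of the fast
subsystem times `dτ/dx = 2n x ^ (2n-1) / F (x, ρ)`, where `τ` is the slow time. -/
def slowDivIntegrand (ρ : EuclideanSpace ℝ (Fin m)) (x : ℝ) : ℝ :=
  -(2 * (n : ℝ) * x ^ (2 * n - 1)) ^ 2 / X.F (x, ρ)

/-- The slow divergence integral `J₋` along the attracting part. -/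
def JMinus (y : ℝ) (ρ : EuclideanSpace ℝ (Fin m)) : ℝ :=
  ∫ x in (omegaPt n y)..0, X.slowDivIntegrand ρ x

/-- The slow divergence integral `J₊` along the repelling part. -/
def JPlus (y : ℝ) (ρ : EuclideanSpace ℝ (Fin m)) : ℝ :=
  ∫ x in (alphaPt n y)..0, X.slowDivIntegrand ρ x

/-- `y` is the entry-exit orbit with initial point `y₀` in the section `0 < y < δ`:
if `J₋ - J₊ < 0` on the section, then `J₋(y_{l+1}) = J₊(y_l)`, and
if `J₋ - J₊ > 0` on the section, then `J₋(y_l) = J₊(y_{l+1})` (all at `ρ = 0`). -/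
structure IsEntryExitOrbit (δ y₀ : ℝ) (y : ℕ → ℝ) : Prop where
  init : y 0 = y₀
  mem_section : ∀ l, y l ∈ Ioo 0 δ
  step :
    ((∀ t ∈ Ioo 0 δ, X.JMinus t 0 - X.JPlus t 0 < 0) ∧
        ∀ l, X.JMinus (y (l + 1)) 0 = X.JPlus (y l) 0) ∨
      ((∀ t ∈ Ioo 0 δ, 0 < X.JMinus t 0 - X.JPlus t 0) ∧
        ∀ l, X.JMinus (y l) 0 = X.JPlus (y (l + 1)) 0)

/-- The union `𝒰` of the fast intervals `]α(y_l), ω(y_l)[ × {y_l}`. -/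
def chirp (n : ℕ) (y : ℕ → ℝ) : Set (EuclideanSpace ℝ (Fin 2)) :=
  horizontalIntervals (fun l => alphaPt n (y l)) (fun l => omegaPt n (y l)) y

end

end LienardFamily

/-! With w = ω(y) = y^(1/2n), and with the repelling branch reflected by x ↦ -x, both slow
divergence integrals become, up to a common sign, integrals over [0, w] of the positive densities
4n²x^(4n-2)/(-F(x,0)) and 4n²x^(4n-2)/F(-x,0). Both have order x^(2n-1). Their difference is
governed by F(x,0) + F(-x,0), whose leading term is 2f_{2k}x^(2k); it therefore has constant sign
and order x^(2k) (`exists_comparableDensities`).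

Call the larger density P and the smaller Q. One entry-exit step from w to v reads ∫₀^v P = ∫₀^w Q,
that is ∫_v^w P = ∫₀^w (P - Q). The left side is comparable to w^(2n) - v^(2n), the gap between the
levels, and the right side to w^(2k+1) (`exists_step_bounds`). Hence w_l - w_{l+1} has order
w_l^(2(k-n)+2), so w_l^(-(2(k-n)+1)) grows linearly in l (`inv_pow_linear_growth`), and every power
law follows.

For the dimensions, put β = 2n/(2(k-n)+1) and split the ε-neighbourhood at the index L ≈
ε^(-1/(β+1)), where gaps become comparable to ε. Earlier pieces are counted one by one, later ones
form a nucleus of height about ε^(β/(β+1)). The nucleus alone gives the lower volume bounds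
(`exists_dense_nucleus`, `hasBoxDim_range`, `hasBoxDim_horizontalIntervals`). -/

/-! ### Box dimension of slowly decreasing sequences -/

/-- Two-sided power bounds for the volume of the `ε`-neighbourhoods determine the box dimension. -/
theorem hasBoxDim_of_volume_bounds {E : Type*} [NormedAddCommGroup E] [NormedSpace ℝ E]
    [MeasureSpace E] {A : Set E} {d : ℝ} (hd : 0 ≤ d)
    (hup : ∀ s > d, ∃ C : ℝ, ∀ᶠ ε in 𝓝[>] (0 : ℝ),
      volume (Metric.thickening ε A) ≤
        ENNReal.ofReal (C * ε ^ ((Module.finrank ℝ E : ℝ) - s)))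
    (hlow : ∃ c : ℝ, 0 < c ∧ ∀ᶠ ε in 𝓝[>] (0 : ℝ),
      ENNReal.ofReal (c * ε ^ ((Module.finrank ℝ E : ℝ) - d)) ≤
        volume (Metric.thickening ε A)) :
    HasBoxDim A d := by
  have hpos : ∀ᶠ ε in 𝓝[>] (0 : ℝ), 0 < ε ∧ ε < 1 := by
    filter_upwards [Ioo_mem_nhdsGT (zero_lt_one' ℝ)] with ε hε using hε
  have hle : ∀ s, lowerMinkowskiContent s A ≤ upperMinkowskiContent s A := fun s =>
    liminf_le_limsup
  have hzero : ∀ s > d, upperMinkowskiContent s A = 0 := by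
    intro s hs
    -- The bound at the midpoint of d and s leaves a spare factor ε^((s-d)/2), which sends the
    -- content at s to 0.
    obtain ⟨C, hC⟩ := hup ((s + d) / 2) (by linarith)
    have hlim : Tendsto (fun ε : ℝ => ENNReal.ofReal (C * ε ^ ((s - d) / 2))) (𝓝[>] (0 : ℝ))
        (𝓝 0) := by
      have h1 : Tendsto (fun ε : ℝ => C * ε ^ ((s - d) / 2)) (𝓝 (0 : ℝ))
          (𝓝 (C * (0 : ℝ) ^ ((s - d) / 2))) :=
        ((Real.continuous_rpow_const (by linarith)).tendsto 0).const_mul C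
      rw [Real.zero_rpow (by linarith), mul_zero] at h1
      have h2 := (ENNReal.continuous_ofReal.tendsto 0).comp
        (h1.mono_left (nhdsWithin_le_nhds (s := Ioi 0)))
      simpa [Function.comp_def] using h2
    refine Tendsto.limsup_eq (tendsto_of_tendsto_of_tendsto_of_le_of_le' tendsto_const_nhds hlim
      (Eventually.of_forall fun _ => zero_le) ?_)
    filter_upwards [hC, hpos] with ε h1 h2
    refine ENNReal.div_le_of_le_mul (h1.trans_eq ?_)
    rw [← ENNReal.ofReal_mul' (Real.rpow_nonneg h2.1.le _), mul_assoc, ← Real.rpow_add h2.1]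
    congr 3
    ring
  have hne : ∀ s < d, lowerMinkowskiContent s A ≠ 0 := by
    intro s hs
    obtain ⟨c, hc, h⟩ := hlow
    have : ENNReal.ofReal c ≤ lowerMinkowskiContent s A := by
      refine le_liminf_of_le (by isBoundedDefault) ?_
      filter_upwards [h, hpos] with ε h1 h2
      have h3 : 0 < ε ^ ((Module.finrank ℝ E : ℝ) - s) := Real.rpow_pos_of_pos h2.1 _
      rw [minkowskiRatio, ENNReal.le_div_iff_mul_le (Or.inl (by simpa using h3))
        (Or.inl ENNReal.ofReal_ne_top), ← ENNReal.ofReal_mul hc.le]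
      refine le_trans (ENNReal.ofReal_le_ofReal ?_) h1
      exact mul_le_mul_of_nonneg_left
        (Real.rpow_le_rpow_of_exponent_ge h2.1 h2.2.le (by linarith)) hc.le
    exact (lt_of_lt_of_le (by simpa using hc) this).ne'
  have key : ∀ f : ℝ → ENNReal, (∀ s > d, f s = 0) → (∀ s < d, f s ≠ 0) →
      sInf {s : ℝ | 0 ≤ s ∧ f s = 0} = d := by
    intro f h1 h2
    have hb : BddBelow {s : ℝ | 0 ≤ s ∧ f s = 0} := ⟨0, fun s hs => hs.1⟩
    apply le_antisymm
    · refine le_of_forall_gt_imp_ge_of_dense fun s hs => csInf_le hb ⟨hd.trans hs.le, h1 s hs⟩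
    · refine le_csInf ⟨d + 1, by positivity, h1 _ (by linarith)⟩ fun s hs => ?_
      by_contra hlt
      exact h2 s (not_le.mp hlt) hs.2
  refine ⟨key _ (fun s hs => ?_) hne, key _ hzero fun s hs h => hne s hs ?_⟩
  · exact le_antisymm ((hle s).trans_eq (hzero s hs)) zero_le
  · exact le_antisymm ((hle s).trans_eq h) zero_le

/-- Near `0` the points of a slowly decreasing sequence with gaps of order `l ^ (-(β + 1))` are
`ε`-dense in an interval of length of order `ε ^ (β / (β + 1))`. -/
theorem exists_dense_nucleus {y : ℕ → ℝ} {β A C : ℝ} (hβ : 0 < β) (hA : 0 < A) (hC : 0 < C)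
    (htend : Tendsto y atTop (𝓝 0))
    (hlo : ∀ l : ℕ, 1 ≤ l → A * (l : ℝ) ^ (-β) ≤ y l)
    (hgap : ∀ l : ℕ, 1 ≤ l → y l - y (l + 1) ≤ C * (l : ℝ) ^ (-(β + 1))) :
    ∃ c : ℝ, 0 < c ∧ ∀ᶠ ε in 𝓝[>] (0 : ℝ), ∃ η : ℝ, c * ε ^ (β / (β + 1)) ≤ η ∧
      ∀ t ∈ Ioc 0 η, ∃ l, t ≤ y l ∧ y l - t < ε := by
  refine ⟨A * (3 * C ^ (1 / (β + 1))) ^ (-β), by positivity, ?_⟩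
  filter_upwards [Ioo_mem_nhdsGT hC] with ε hε
  have hε0 : 0 < ε := hε.1
  -- M solves C · M^(-(β+1)) = ε: beyond it the gaps are below ε.
  set M : ℝ := (C / ε) ^ (1 / (β + 1)) with hM
  have hCε : 1 ≤ C / ε := by rw [le_div_iff₀ hε0]; linarith [hε.2]
  have hM1 : 1 ≤ M := Real.one_le_rpow hCε (by positivity)
  set L : ℕ := ⌈M⌉₊ + 1 with hL
  have hL1 : M < L := by
    have := Nat.le_ceil M
    rw [hL]; push_cast; linarith
  have hL2 : (L : ℝ) ≤ 3 * M := by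
    have := (Nat.ceil_lt_add_one (by linarith : 0 ≤ M)).le
    rw [hL]; push_cast; linarith
  have hLpos : (0 : ℝ) < L := by linarith
  have hsmall : ∀ l : ℕ, L ≤ l → y l - y (l + 1) < ε := by
    intro l hl
    have hlL : (L : ℝ) ≤ l := by exact_mod_cast hl
    have hl0 : (0 : ℝ) < l := by linarith
    refine lt_of_le_of_lt (hgap l (by omega)) ?_
    have h1 : M ^ (β + 1) < (l : ℝ) ^ (β + 1) :=
      Real.rpow_lt_rpow (by linarith) (by linarith) (by positivity)
    have h2 : M ^ (β + 1) = C / ε := by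
      rw [hM, ← Real.rpow_mul (by positivity), one_div_mul_cancel (by positivity), Real.rpow_one]
    rw [Real.rpow_neg hl0.le, ← div_eq_mul_inv, div_lt_iff₀ (by positivity)]
    rw [h2, div_lt_iff₀ hε0] at h1
    linarith
  refine ⟨y L, ?_, ?_⟩
  · refine le_trans ?_ (hlo L (by omega))
    rw [mul_assoc]
    refine mul_le_mul_of_nonneg_left ?_ hA.le
    have h1 : (3 * M) ^ (-β) ≤ (L : ℝ) ^ (-β) :=
      Real.rpow_le_rpow_of_nonpos hLpos hL2 (by linarith)
    refine le_trans (le_of_eq ?_) h1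
    have h2 : 3 * M = 3 * C ^ (1 / (β + 1)) * ε ^ (-(1 / (β + 1))) := by
      rw [hM, Real.div_rpow hC.le hε0.le, Real.rpow_neg hε0.le]
      ring
    rw [h2, Real.mul_rpow (x := 3 * C ^ (1 / (β + 1))) (by positivity) (by positivity),
      ← Real.rpow_mul hε0.le]
    congr 2
    field_simp
  · intro t ht
    -- The predecessor of the first index ≥ L with y_m < t lies at or above t, and within one gap of
    -- it.
    have hex' : ∃ m, L ≤ m ∧ y m < t := by
      obtain ⟨m, h1, h2⟩ :=
        ((eventually_ge_atTop L).and (htend.eventually (gt_mem_nhds ht.1))).exists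
      exact ⟨m, h1, h2⟩
    classical
    obtain ⟨h1, h2⟩ := Nat.find_spec hex'
    set m := Nat.find hex' with hm
    have hmL : m ≠ L := by
      intro h
      rw [h] at h2
      linarith [ht.2]
    obtain ⟨l, hl⟩ : ∃ l, m = l + 1 := ⟨m - 1, by omega⟩
    have hlL : L ≤ l := by omega
    have h3 : t ≤ y l := by
      by_contra hlt
      have := Nat.find_min' hex' ⟨hlL, not_le.mp hlt⟩
      omega
    refine ⟨l, h3, ?_⟩
    rw [hl] at h2
    linarith [hsmall l hlL]

theorem exists_nat_near_rpow {κ ε : ℝ} (hκ : 0 < κ) (hε : 0 < ε) (hε1 : ε < 1) :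
    ∃ L : ℕ, 1 ≤ L ∧ ε ^ (-κ) ≤ L ∧ (L : ℝ) ≤ 2 * ε ^ (-κ) := by
  have h1 : 1 ≤ ε ^ (-κ) := Real.one_le_rpow_of_pos_of_le_one_of_nonpos hε hε1.le (by linarith)
  have h2 := Nat.le_ceil (ε ^ (-κ))
  have h3 := (Nat.ceil_lt_add_one (by linarith : 0 ≤ ε ^ (-κ))).le
  refine ⟨⌈ε ^ (-κ)⌉₊, ?_, h2, by linarith⟩
  exact_mod_cast (h1.trans h2)

/-- Induction on L: Bernoulli's inequality for the concave power 1 - p bounds each new term by the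
increment of the right-hand side. -/
theorem sum_rpow_neg_le {p : ℝ} (hp : 0 ≤ p) (hp1 : p < 1) (L : ℕ) :
    ∑ l ∈ Finset.range L, ((l + 1 : ℕ) : ℝ) ^ (-p) ≤ (L : ℝ) ^ (1 - p) / (1 - p) := by
  induction L with
  | zero => simp [Real.zero_rpow (by linarith : (1 - p) ≠ 0)]
  | succ L ih =>
    rw [Finset.sum_range_succ]
    have hl : (0 : ℝ) < ((L + 1 : ℕ) : ℝ) := by positivity
    have hq : 0 < 1 - p := by linarith
    have h0 : 1 + -(1 / ((L + 1 : ℕ) : ℝ)) = L / ((L + 1 : ℕ) : ℝ) := by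
      push_cast
      field_simp
      ring
    have h1 := rpow_one_add_le_one_add_mul_self (s := -(1 / ((L + 1 : ℕ) : ℝ)))
      (by
        have : 1 / ((L + 1 : ℕ) : ℝ) ≤ 1 := by
          rw [div_le_one hl]; push_cast; linarith [(Nat.cast_nonneg L : (0 : ℝ) ≤ L)]
        linarith) hq.le (by linarith : 1 - p ≤ 1)
    rw [h0, Real.div_rpow (Nat.cast_nonneg L) hl.le, div_le_iff₀ (by positivity)] at h1
    have h2 : ((L + 1 : ℕ) : ℝ) ^ (-p) = ((L + 1 : ℕ) : ℝ) ^ (1 - p) / ((L + 1 : ℕ) : ℝ) := by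
      rw [sub_eq_add_neg, Real.rpow_add hl, Real.rpow_one]
      field_simp
    have h3 : (L : ℝ) ^ (1 - p) / (1 - p) + ((L + 1 : ℕ) : ℝ) ^ (-p) ≤
        ((L + 1 : ℕ) : ℝ) ^ (1 - p) / (1 - p) := by
      rw [h2, div_add' _ _ _ hq.ne']
      gcongr
      calc _ ≤ (1 + (1 - p) * -(1 / ((L + 1 : ℕ) : ℝ))) * ((L + 1 : ℕ) : ℝ) ^ (1 - p)
            + ((L + 1 : ℕ) : ℝ) ^ (1 - p) / ((L + 1 : ℕ) : ℝ) * (1 - p) := by gcongr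
        _ = _ := by ring
    linarith

/-- The first L ≈ ε^(-1/(β+1)) points cost 2ε each and the rest lie in an interval of length about
L^(-β) + ε. Both contributions are of order ε^(1-1/(β+1)), and the dense nucleus shows that this
order is attained. -/
theorem hasBoxDim_range {y : ℕ → ℝ} {β A B C : ℝ} (hβ : 0 < β) (hA : 0 < A) (hC : 0 < C)
    (hanti : StrictAnti y) (hpos : ∀ l, 0 < y l) (htend : Tendsto y atTop (𝓝 0))
    (hlo : ∀ l : ℕ, 1 ≤ l → A * (l : ℝ) ^ (-β) ≤ y l)
    (hhi : ∀ l : ℕ, 1 ≤ l → y l ≤ B * (l : ℝ) ^ (-β))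
    (hgap : ∀ l : ℕ, 1 ≤ l → y l - y (l + 1) ≤ C * (l : ℝ) ^ (-(β + 1))) :
    HasBoxDim (range y) (1 / (β + 1)) := by
  have hdim : (Module.finrank ℝ ℝ : ℝ) = 1 := by simp
  have hB : 0 < B := by
    have := (hpos 1).trans_le (hhi 1 le_rfl)
    simpa using this
  apply hasBoxDim_of_volume_bounds (by positivity)
  · intro s hs
    refine ⟨B + 6, ?_⟩
    filter_upwards [Ioo_mem_nhdsGT (zero_lt_one' ℝ)] with ε hε
    have hε0 : 0 < ε := hε.1
    obtain ⟨L, hL1, hL2, hL3⟩ :=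
      exists_nat_near_rpow (κ := 1 / (β + 1)) (by positivity) hε.1 hε.2
    have hcover : Metric.thickening ε (range y) ⊆
        (⋃ l ∈ Finset.range L, Ioo (y l - ε) (y l + ε)) ∪ Ioo (-ε) (y L + ε) := by
      intro t ht
      obtain ⟨_, ⟨l, rfl⟩, hl⟩ := Metric.mem_thickening_iff.mp ht
      rw [Real.dist_eq, abs_lt] at hl
      by_cases h : l < L
      · left
        simp only [Finset.mem_range, mem_iUnion]
        exact ⟨l, h, by linarith, by linarith⟩
      · right
        have := hanti.antitone (not_lt.mp h)
        have := hpos l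
        constructor <;> linarith
    refine (measure_mono hcover).trans ((measure_union_le _ _).trans ?_)
    have h1 : volume (⋃ l ∈ Finset.range L, Ioo (y l - ε) (y l + ε)) ≤
        ENNReal.ofReal (L * (2 * ε)) := by
      refine (measure_biUnion_finset_le _ _).trans (le_of_eq ?_)
      have : ∀ l, y l + ε - (y l - ε) = 2 * ε := fun l => by ring
      simp only [Real.volume_Ioo, this, Finset.sum_const, Finset.card_range, nsmul_eq_mul]
      rw [ENNReal.ofReal_mul (Nat.cast_nonneg L), ENNReal.ofReal_natCast]
    refine (add_le_add h1 (Real.volume_Ioo).le).trans ?_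
    rw [← ENNReal.ofReal_add (by positivity) (by linarith [hpos L])]
    apply ENNReal.ofReal_le_ofReal
    rw [hdim]
    have e1 : ε * ε ^ (-(1 / (β + 1))) = ε ^ (1 - 1 / (β + 1)) := by
      rw [sub_eq_add_neg, Real.rpow_add hε0, Real.rpow_one]
    have e2 : ε ^ (1 - 1 / (β + 1)) ≤ ε ^ (1 - s) :=
      Real.rpow_le_rpow_of_exponent_ge hε0 hε.2.le (by linarith)
    have e3 : ε ≤ ε ^ (1 - s) := by
      conv_lhs => rw [← Real.rpow_one ε]
      refine Real.rpow_le_rpow_of_exponent_ge hε0 hε.2.le ?_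
      have : (0 : ℝ) < 1 / (β + 1) := by positivity
      linarith
    have e4 : y L ≤ B * ε ^ (1 - 1 / (β + 1)) := by
      refine (hhi L hL1).trans (mul_le_mul_of_nonneg_left ?_ hB.le)
      calc (L : ℝ) ^ (-β) ≤ (ε ^ (-(1 / (β + 1)))) ^ (-β) :=
            Real.rpow_le_rpow_of_nonpos (by positivity) hL2 (by linarith)
        _ = _ := by
            rw [← Real.rpow_mul hε0.le]
            congr 1
            field_simp
            ring
    have e5 : (L : ℝ) * (2 * ε) ≤ 4 * ε ^ (1 - 1 / (β + 1)) := by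
      rw [← e1]
      calc (L : ℝ) * (2 * ε) ≤ 2 * ε ^ (-(1 / (β + 1))) * (2 * ε) := by gcongr
        _ = _ := by ring
    have e6 : B * ε ^ (1 - 1 / (β + 1)) ≤ B * ε ^ (1 - s) := mul_le_mul_of_nonneg_left e2 hB.le
    linarith
  · obtain ⟨c, hc, h⟩ := exists_dense_nucleus hβ hA hC htend hlo hgap
    refine ⟨c, hc, ?_⟩
    filter_upwards [h] with ε hε
    obtain ⟨η, hη, hd⟩ := hε
    have hsub : Ioc 0 η ⊆ Metric.thickening ε (range y) := by
      intro t ht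
      obtain ⟨l, h1, h2⟩ := hd t ht
      refine Metric.mem_thickening_iff.mpr ⟨y l, ⟨l, rfl⟩, ?_⟩
      rw [Real.dist_eq, abs_lt]
      constructor <;> linarith
    refine le_trans ?_ (measure_mono hsub)
    rw [Real.volume_Ioc, sub_zero, hdim]
    apply ENNReal.ofReal_le_ofReal
    refine le_trans (le_of_eq ?_) hη
    congr 2
    field_simp
    ring

/-! ### Box dimension of chirps in the plane -/

theorem volume_rectangle (a b c d : ℝ) :
    volume {p : EuclideanSpace ℝ (Fin 2) | p 0 ∈ Ioo a b ∧ p 1 ∈ Ioo c d} =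
      ENNReal.ofReal (b - a) * ENNReal.ofReal (d - c) := by
  have h := (EuclideanSpace.volume_preserving_symm_measurableEquiv_toLp (Fin 2)).symm
  have hset : {p : EuclideanSpace ℝ (Fin 2) | p 0 ∈ Ioo a b ∧ p 1 ∈ Ioo c d} =
      (MeasurableEquiv.toLp 2 (Fin 2 → ℝ)).symm ⁻¹'
        (Set.pi univ ![Ioo a b, Ioo c d]) := by
    ext p
    simp [Set.mem_pi, Fin.forall_fin_two]
  rw [hset, (EuclideanSpace.volume_preserving_symm_measurableEquiv_toLp
    (Fin 2)).measure_preimage_equiv, volume_pi_pi, Fin.prod_univ_two]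
  simp

theorem abs_coord_sub_le_dist (p q : EuclideanSpace ℝ (Fin 2)) (i : Fin 2) :
    |p i - q i| ≤ dist p q := by
  have := PiLp.norm_apply_le (p - q) i
  rwa [← dist_eq_norm, PiLp.sub_apply, Real.norm_eq_abs] at this

/-- Each of the first L intervals gets its own rectangle; all later ones are lower and narrower, so
a single rectangle holds them. -/
theorem thickening_horizontalIntervals_subset {y : ℕ → ℝ} {σ ε : ℝ} (hσ : 0 < σ)
    (hanti : StrictAnti y) (hpos : ∀ l, 0 < y l) (L : ℕ) :
    Metric.thickening ε (horizontalIntervals (fun l => -(y l) ^ σ) (fun l => (y l) ^ σ) y) ⊆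
      (⋃ l ∈ Finset.range L, {p : EuclideanSpace ℝ (Fin 2) |
        p 0 ∈ Ioo (-((y l) ^ σ + ε)) ((y l) ^ σ + ε) ∧ p 1 ∈ Ioo (y l - ε) (y l + ε)}) ∪
      {p : EuclideanSpace ℝ (Fin 2) |
        p 0 ∈ Ioo (-((y L) ^ σ + ε)) ((y L) ^ σ + ε) ∧ p 1 ∈ Ioo (-ε) (y L + ε)} := by
  intro p hp
  obtain ⟨z, hz, hd⟩ := Metric.mem_thickening_iff.mp hp
  obtain ⟨l, ⟨hz1, hz2⟩, hz3⟩ := mem_iUnion.mp hz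
  have h0 := abs_lt.mp ((abs_coord_sub_le_dist p z 0).trans_lt hd)
  have h1 := abs_lt.mp ((abs_coord_sub_le_dist p z 1).trans_lt hd)
  rw [hz3] at h1
  by_cases h : l < L
  · left
    simp only [Finset.mem_range, mem_iUnion]
    exact ⟨l, h, ⟨by linarith, by linarith⟩, by linarith, by linarith⟩
  · right
    have hy := hanti.antitone (not_lt.mp h)
    have hw := Real.rpow_le_rpow (hpos l).le hy hσ.le
    have := hpos l
    exact ⟨⟨by linarith, by linarith⟩, by linarith, by linarith⟩

theorem volume_thickening_horizontalIntervals_le {y : ℕ → ℝ} {σ ε : ℝ} (hσ : 0 < σ) (hε : 0 < ε)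
    (hanti : StrictAnti y) (hpos : ∀ l, 0 < y l) (L : ℕ) :
    volume (Metric.thickening ε
      (horizontalIntervals (fun l => -(y l) ^ σ) (fun l => (y l) ^ σ) y)) ≤
      ENNReal.ofReal (∑ l ∈ Finset.range L, (2 * ((y l) ^ σ + ε)) * (2 * ε) +
        (2 * ((y L) ^ σ + ε)) * (y L + 2 * ε)) := by
  have hw : ∀ l, 0 < (y l) ^ σ := fun l => Real.rpow_pos_of_pos (hpos l) _
  refine (measure_mono (thickening_horizontalIntervals_subset hσ hanti hpos L)).trans
    ((measure_union_le _ _).trans ?_)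
  rw [ENNReal.ofReal_add
    (Finset.sum_nonneg fun l _ => by have := hw l; positivity)
    (by have := hw L; have := hpos L; positivity)]
  refine add_le_add ?_ (le_of_eq ?_)
  · refine (measure_biUnion_finset_le _ _).trans (le_of_eq ?_)
    rw [ENNReal.ofReal_sum_of_nonneg fun l _ => by have := hw l; positivity]
    refine Finset.sum_congr rfl fun l _ => ?_
    rw [volume_rectangle, ← ENNReal.ofReal_mul (by have := hw l; linarith)]
    congr 1
    ring
  · rw [volume_rectangle, ← ENNReal.ofReal_mul (by have := hw L; linarith)]
    congr 1
    ring

/-- The nucleus has height of order ε^(β/(β+1)) and width the σ-th power of that, hence area of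
order ε^((β+βσ)/(β+1)). The condition βσ ≤ 1 keeps the separate strips from dominating, apart from a
logarithm when βσ = 1. -/
theorem hasBoxDim_horizontalIntervals {y : ℕ → ℝ} {β σ A B C : ℝ} (hβ : 0 < β) (hσ : 0 < σ)
    (hβσ : β * σ ≤ 1) (hA : 0 < A) (hC : 0 < C)
    (hanti : StrictAnti y) (hpos : ∀ l, 0 < y l) (htend : Tendsto y atTop (𝓝 0))
    (hlo : ∀ l : ℕ, 1 ≤ l → A * (l : ℝ) ^ (-β) ≤ y l)
    (hhi : ∀ l : ℕ, 1 ≤ l → y l ≤ B * (l : ℝ) ^ (-β))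
    (hgap : ∀ l : ℕ, 1 ≤ l → y l - y (l + 1) ≤ C * (l : ℝ) ^ (-(β + 1))) :
    HasBoxDim (horizontalIntervals (fun l => -(y l) ^ σ) (fun l => (y l) ^ σ) y)
      (2 - (β + β * σ) / (β + 1)) := by
  have hdim : (Module.finrank ℝ (EuclideanSpace ℝ (Fin 2)) : ℝ) = 2 := by simp
  have hB : 0 < B := by
    have := (hpos 1).trans_le (hhi 1 le_rfl)
    simpa using this
  have hγ0 : 0 < β * σ := by positivity
  have hfrac : (β + β * σ) / (β + 1) ≤ 1 := by
    rw [div_le_one (by positivity)]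
    linarith
  apply hasBoxDim_of_volume_bounds (by linarith)
  · intro s hs
    set θ : ℝ := 2 - s with hθ
    have hθlt : θ < (β + β * σ) / (β + 1) := by linarith
    set κ : ℝ := 1 / (β + 1) with hκ
    have hκ0 : 0 < κ := by positivity
    have hκ1 : κ ≤ 1 := by
      rw [hκ, div_le_one (by positivity)]
      linarith
    have hκβ : κ * β = 1 - κ := by
      rw [hκ]
      field_simp
      ring
    have hfr : (β + β * σ) / (β + 1) = 1 - κ * (1 - β * σ) := by
      rw [hκ]
      field_simp
      ring
    -- The widths decay like l^(-βσ), whose sum is logarithmic when βσ = 1. A weaker decay exponent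
    -- g < 1 avoids the logarithm; since s > d, the loss in the power of ε is affordable.
    obtain ⟨g, hg0, hgγ, hg1, hgθ⟩ :
        ∃ g : ℝ, 0 ≤ g ∧ g ≤ β * σ ∧ g < 1 ∧ θ ≤ 1 - κ * (1 - g) := by
      have h1 : (θ - 1) / κ + 1 < β * σ := by
        rw [← lt_sub_iff_add_lt, div_lt_iff₀ hκ0]
        linarith
      refine ⟨max 0 ((θ - 1) / κ + 1), le_max_left _ _, max_le hγ0.le h1.le,
        max_lt one_pos (by linarith), ?_⟩
      have h2 := le_max_right 0 ((θ - 1) / κ + 1)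
      have h3 : κ * ((θ - 1) / κ + 1) = θ - 1 + κ := by field_simp
      have h4 := mul_le_mul_of_nonneg_left h2 hκ0.le
      linarith
    refine ⟨4 * ((y 0) ^ σ + B ^ σ * (2 ^ (1 - g) / (1 - g))) + 8 +
      2 * (B ^ σ + 1) * (B + 2), ?_⟩
    filter_upwards [Ioo_mem_nhdsGT (zero_lt_one' ℝ)] with ε hε
    have hε0 : 0 < ε := hε.1
    have hmono : ∀ {p r : ℝ}, r ≤ p → ε ^ p ≤ ε ^ r := fun h =>
      Real.rpow_le_rpow_of_exponent_ge hε0 hε.2.le h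
    obtain ⟨L, hL1, hL2, hL3⟩ := exists_nat_near_rpow (κ := κ) hκ0 hε.1 hε.2
    refine (volume_thickening_horizontalIntervals_le hσ hε0 hanti hpos L).trans
      (ENNReal.ofReal_le_ofReal ?_)
    rw [hdim, ← hθ]
    have hw : ∀ l : ℕ, 1 ≤ l → (y l) ^ σ ≤ B ^ σ * (l : ℝ) ^ (-(β * σ)) := by
      intro l hl
      refine (Real.rpow_le_rpow (hpos l).le (hhi l hl) hσ.le).trans (le_of_eq ?_)
      rw [Real.mul_rpow hB.le (by positivity), ← Real.rpow_mul (by positivity)]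
      congr 2
      ring
    have hwg : ∀ l : ℕ, 1 ≤ l → (y l) ^ σ ≤ B ^ σ * (l : ℝ) ^ (-g) := by
      intro l hl
      refine (hw l hl).trans ?_
      have : (1 : ℝ) ≤ l := by exact_mod_cast hl
      gcongr
    have hsum : ∑ l ∈ Finset.range L, (y l) ^ σ ≤
        (y 0) ^ σ + B ^ σ * ((L : ℝ) ^ (1 - g) / (1 - g)) := by
      calc ∑ l ∈ Finset.range L, (y l) ^ σ ≤ ∑ l ∈ Finset.range (L + 1), (y l) ^ σ :=
            Finset.sum_le_sum_of_subset_of_nonneg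
              (Finset.range_mono (Nat.le_succ L))
              fun l _ _ => Real.rpow_nonneg (hpos l).le _
        _ = ∑ l ∈ Finset.range L, (y (l + 1)) ^ σ + (y 0) ^ σ := Finset.sum_range_succ' _ _
        _ ≤ ∑ l ∈ Finset.range L, B ^ σ * ((l + 1 : ℕ) : ℝ) ^ (-g) + (y 0) ^ σ := by
            gcongr with l _
            exact hwg (l + 1) (by omega)
        _ ≤ _ := by
            rw [← Finset.mul_sum, add_comm]
            gcongr
            exact sum_rpow_neg_le hg0 hg1 L
    have hε1 : ε ≤ ε ^ θ := by
      conv_lhs => rw [← Real.rpow_one ε]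
      exact hmono (by linarith)
    have hLg : ε * (L : ℝ) ^ (1 - g) ≤ 2 ^ (1 - g) * ε ^ θ := by
      calc ε * (L : ℝ) ^ (1 - g) ≤ ε * (2 * ε ^ (-κ)) ^ (1 - g) := by
            have : 0 ≤ 1 - g := by linarith
            gcongr
        _ = 2 ^ (1 - g) * ε ^ (1 - κ * (1 - g)) := by
            rw [Real.mul_rpow (by norm_num) (by positivity), ← Real.rpow_mul hε0.le,
              sub_eq_add_neg 1 (κ * (1 - g)), Real.rpow_add hε0, Real.rpow_one, neg_mul]
            ring
        _ ≤ _ := by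
            exact mul_le_mul_of_nonneg_left (hmono hgθ) (by positivity)
    have hLε : (L : ℝ) * (ε * ε) ≤ 2 * ε ^ θ := by
      have e1 : ε * ε ^ (-κ) = ε ^ (1 - κ) := by
        rw [sub_eq_add_neg, Real.rpow_add hε0, Real.rpow_one]
      have e2 : ε ^ (1 - κ) ≤ 1 := Real.rpow_le_one hε0.le hε.2.le (by linarith)
      calc (L : ℝ) * (ε * ε) ≤ 2 * ε ^ (-κ) * (ε * ε) := by gcongr
        _ = 2 * (ε * ε ^ (1 - κ)) := by rw [← e1]; ring
        _ ≤ 2 * (ε ^ θ * 1) := by gcongr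
        _ = _ := by ring
    have hLpow : ∀ p : ℝ, 0 ≤ p → (L : ℝ) ^ (-p) ≤ ε ^ (κ * p) := by
      intro p hp
      calc (L : ℝ) ^ (-p) ≤ (ε ^ (-κ)) ^ (-p) :=
            Real.rpow_le_rpow_of_nonpos (by positivity) hL2 (by linarith)
        _ = _ := by
            rw [← Real.rpow_mul hε0.le]
            congr 1
            ring
    have hyL : y L + 2 * ε ≤ (B + 2) * ε ^ (κ * β) := by
      have e1 : y L ≤ B * ε ^ (κ * β) :=
        (hhi L hL1).trans (mul_le_mul_of_nonneg_left (hLpow β hβ.le) hB.le)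
      have e2 : ε ≤ ε ^ (κ * β) := by
        conv_lhs => rw [← Real.rpow_one ε]
        exact hmono (by linarith)
      linarith
    have hwL : (y L) ^ σ + ε ≤ (B ^ σ + 1) * ε ^ (κ * (β * σ)) := by
      have e1 : (y L) ^ σ ≤ B ^ σ * ε ^ (κ * (β * σ)) :=
        (hw L hL1).trans (mul_le_mul_of_nonneg_left (hLpow _ hγ0.le) (by positivity))
      have e2 : ε ≤ ε ^ (κ * (β * σ)) := by
        conv_lhs => rw [← Real.rpow_one ε]
        exact hmono (by nlinarith)
      linarith
    have hnucleus : 2 * ((y L) ^ σ + ε) * (y L + 2 * ε) ≤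
        2 * (B ^ σ + 1) * (B + 2) * ε ^ θ := by
      have := hpos L
      calc 2 * ((y L) ^ σ + ε) * (y L + 2 * ε)
          ≤ 2 * ((B ^ σ + 1) * ε ^ (κ * (β * σ))) * ((B + 2) * ε ^ (κ * β)) := by gcongr
        _ = 2 * (B ^ σ + 1) * (B + 2) * ε ^ (κ * (β * σ) + κ * β) := by
            rw [Real.rpow_add hε0]
            ring
        _ ≤ _ := by
            exact mul_le_mul_of_nonneg_left (hmono (by linarith)) (by positivity)
    have hsplit : ∑ l ∈ Finset.range L, 2 * ((y l) ^ σ + ε) * (2 * ε) =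
        4 * (ε * ∑ l ∈ Finset.range L, (y l) ^ σ) + 4 * (L * (ε * ε)) := by
      have : ∀ l, 2 * ((y l) ^ σ + ε) * (2 * ε) = 4 * ε * (y l) ^ σ + 4 * (ε * ε) :=
        fun l => by ring
      simp only [this, Finset.sum_add_distrib, ← Finset.mul_sum, Finset.sum_const,
        Finset.card_range, nsmul_eq_mul]
      ring
    have hstrips : ε * ∑ l ∈ Finset.range L, (y l) ^ σ ≤
        ((y 0) ^ σ + B ^ σ * (2 ^ (1 - g) / (1 - g))) * ε ^ θ := by
      have h0 : 0 ≤ (y 0) ^ σ := Real.rpow_nonneg (hpos 0).le _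
      have hg' : 0 < 1 - g := by linarith
      calc ε * ∑ l ∈ Finset.range L, (y l) ^ σ
          ≤ ε * ((y 0) ^ σ + B ^ σ * ((L : ℝ) ^ (1 - g) / (1 - g))) := by gcongr
        _ = (y 0) ^ σ * ε + B ^ σ * ((ε * (L : ℝ) ^ (1 - g)) / (1 - g)) := by ring
        _ ≤ (y 0) ^ σ * ε ^ θ + B ^ σ * ((2 ^ (1 - g) * ε ^ θ) / (1 - g)) := by gcongr
        _ = _ := by ring
    rw [hsplit]
    linarith
  · obtain ⟨c, hc, h⟩ := exists_dense_nucleus hβ hA hC htend hlo hgap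
    refine ⟨(c / 2) ^ σ * c, by positivity, ?_⟩
    filter_upwards [h, self_mem_nhdsWithin] with ε hε hε0
    rw [mem_Ioi] at hε0
    obtain ⟨η, hη, hd⟩ := hε
    have hη0 : 0 < η := lt_of_lt_of_le (by positivity) hη
    -- Heights above η/2 guarantee that the nearby level y_l ≥ p 1 carries an interval of half-width
    -- at least (η/2)^σ.
    have hsub : {p : EuclideanSpace ℝ (Fin 2) |
        p 0 ∈ Ioo (-(η / 2) ^ σ) ((η / 2) ^ σ) ∧ p 1 ∈ Ioo (η / 2) η} ⊆
        Metric.thickening ε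
          (horizontalIntervals (fun l => -(y l) ^ σ) (fun l => (y l) ^ σ) y) := by
      rintro p ⟨hp0, hp1⟩
      obtain ⟨l, h1, h2⟩ := hd (p 1) ⟨by linarith [hp1.1], hp1.2.le⟩
      have hle : (η / 2) ^ σ ≤ (y l) ^ σ :=
        Real.rpow_le_rpow (by positivity) (by linarith [hp1.1]) hσ.le
      refine Metric.mem_thickening_iff.mpr ⟨!₂[p 0, y l], mem_iUnion.mpr ⟨l, ?_⟩, ?_⟩
      · refine ⟨⟨?_, ?_⟩, ?_⟩
        · simp only [Matrix.cons_val_zero]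
          linarith [hp0.1]
        · simp only [Matrix.cons_val_zero]
          linarith [hp0.2]
        · simp
      · rw [EuclideanSpace.dist_eq, Fin.sum_univ_two]
        simp only [Matrix.cons_val_zero, Matrix.cons_val_one, dist_self]
        rw [Real.dist_eq, zero_pow two_ne_zero, zero_add, Real.sqrt_sq (abs_nonneg _), abs_lt]
        constructor <;> linarith
    refine le_trans ?_ (measure_mono hsub)
    rw [volume_rectangle, ← ENNReal.ofReal_mul (by
      have : 0 < (η / 2) ^ σ := by positivity
      linarith), hdim]
    apply ENNReal.ofReal_le_ofReal
    have e1 : (c / 2 * ε ^ (β / (β + 1))) ^ σ ≤ (η / 2) ^ σ :=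
      Real.rpow_le_rpow (by positivity) (by linarith) hσ.le
    calc (c / 2) ^ σ * c * ε ^ (2 - (2 - (β + β * σ) / (β + 1)))
        = (c / 2 * ε ^ (β / (β + 1))) ^ σ * (c * ε ^ (β / (β + 1))) := by
          rw [Real.mul_rpow (by positivity) (by positivity), ← Real.rpow_mul hε0.le,
            show 2 - (2 - (β + β * σ) / (β + 1)) = β / (β + 1) * σ + β / (β + 1) by ring,
            Real.rpow_add hε0]
          ring
      _ ≤ (η / 2) ^ σ * η := by gcongr
      _ = _ := by ring

/-! ### Power-law decay from the size of the gaps -/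

/-- With `pow_sub_pow_le_mul_sub`, this makes gaps of w^(N+1) and gaps of w interchangeable up to
the factor w^N and a constant. -/
theorem sub_mul_pow_le_pow_sub_pow {v w : ℝ} (hv : 0 ≤ v) (hvw : v ≤ w) (N : ℕ) :
    (w - v) * w ^ N ≤ w ^ (N + 1) - v ^ (N + 1) := by
  have h := mul_le_mul_of_nonneg_left (pow_le_pow_left₀ hv hvw N) hv
  rw [pow_succ', pow_succ']
  linarith

theorem pow_sub_pow_le_mul_sub {v w : ℝ} (hv : 0 ≤ v) (hvw : v ≤ w) (N : ℕ) :
    w ^ (N + 1) - v ^ (N + 1) ≤ (N + 1) * ((w - v) * w ^ N) := by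
  induction N with
  | zero => simp
  | succ N ih =>
    have h1 := mul_le_mul_of_nonneg_left ih (hv.trans hvw)
    have h2 := mul_le_mul_of_nonneg_left (pow_le_pow_left₀ hv hvw (N + 1))
      (sub_nonneg.mpr hvw)
    have e1 : w ^ (N + 1 + 1) - v ^ (N + 1 + 1) =
        w * (w ^ (N + 1) - v ^ (N + 1)) + (w - v) * v ^ (N + 1) := by ring
    have e2 : ((N + 1 : ℕ) + 1 : ℝ) * ((w - v) * w ^ (N + 1)) =
        w * ((N + 1) * ((w - v) * w ^ N)) + (w - v) * w ^ (N + 1) := by push_cast; ring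
    rw [e1, e2]
    linarith

/-- If the gaps of `w` are of order `w ^ (q + 1)`, then `w ^ (-q)` grows linearly. -/
theorem inv_pow_linear_growth {w : ℕ → ℝ} {q : ℕ} {a b : ℝ} (ha : 0 < a) (hb : 0 < b)
    (hpos : ∀ l, 0 < w l) (hanti : Antitone w)
    (hlo : ∀ l, a * w l ^ (q + 2) ≤ w l - w (l + 1))
    (hhi : ∀ l, w l - w (l + 1) ≤ b * w l ^ (q + 2))
    (hsmall : b * w 0 ^ (q + 1) ≤ 1 / 2) :
    ∃ A B : ℝ, 0 < A ∧ 0 < B ∧ ∀ l : ℕ, 1 ≤ l →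
      A * l ≤ (w l ^ (q + 1))⁻¹ ∧ (w l ^ (q + 1))⁻¹ ≤ B * l := by
  set c : ℝ := (q + 1) * b * 2 ^ (q + 1) with hc
  have hc0 : 0 < c := by positivity
  have step : ∀ l, (w l ^ (q + 1))⁻¹ + a ≤ (w (l + 1) ^ (q + 1))⁻¹ ∧
      (w (l + 1) ^ (q + 1))⁻¹ ≤ (w l ^ (q + 1))⁻¹ + c := by
    intro l
    have h0 := hpos l
    have h1 := hpos (l + 1)
    have hle := hanti (Nat.le_succ l)
    -- The smallness at l = 0 makes each gap at most half of w_l; w_l and w_{l+1} are then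
    -- comparable, which the upper bound on the increment needs.
    have hhalf : w l ≤ 2 * w (l + 1) := by
      have e1 : b * w l ^ (q + 1) ≤ 1 / 2 :=
        (mul_le_mul_of_nonneg_left (pow_le_pow_left₀ h0.le (hanti (Nat.zero_le l)) _) hb.le).trans
          hsmall
      have e2 : b * w l ^ (q + 2) = b * w l ^ (q + 1) * w l := by ring
      have e3 := mul_le_mul_of_nonneg_right e1 h0.le
      have := hhi l
      linarith
    have g1 := sub_mul_pow_le_pow_sub_pow h1.le hle q
    have g2 := pow_sub_pow_le_mul_sub h1.le hle q
    have hdiff : (w (l + 1) ^ (q + 1))⁻¹ - (w l ^ (q + 1))⁻¹ =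
        (w l ^ (q + 1) - w (l + 1) ^ (q + 1)) / (w l ^ (q + 1) * w (l + 1) ^ (q + 1)) := by
      field_simp
    have hlower : a ≤ (w (l + 1) ^ (q + 1))⁻¹ - (w l ^ (q + 1))⁻¹ := by
      rw [hdiff, le_div_iff₀ (by positivity)]
      calc a * (w l ^ (q + 1) * w (l + 1) ^ (q + 1)) ≤ a * (w l ^ (q + 1) * w l ^ (q + 1)) := by
            gcongr
        _ = a * w l ^ (q + 2) * w l ^ q := by ring
        _ ≤ (w l - w (l + 1)) * w l ^ q := by
            gcongr
            exact hlo l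
        _ ≤ _ := g1
    have hupper : (w (l + 1) ^ (q + 1))⁻¹ - (w l ^ (q + 1))⁻¹ ≤ c := by
      rw [hdiff, div_le_iff₀ (by positivity)]
      calc _ ≤ _ := g2
        _ ≤ (q + 1) * ((b * w l ^ (q + 2)) * w l ^ q) := by
            gcongr
            exact hhi l
        _ = (q + 1) * b * (w l ^ (q + 1) * w l ^ (q + 1)) := by ring
        _ ≤ (q + 1) * b * (w l ^ (q + 1) * (2 * w (l + 1)) ^ (q + 1)) := by gcongr
        _ = _ := by
            rw [hc, mul_pow]
            ring
    constructor <;> linarith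
  have bound : ∀ l : ℕ, (w 0 ^ (q + 1))⁻¹ + a * l ≤ (w l ^ (q + 1))⁻¹ ∧
      (w l ^ (q + 1))⁻¹ ≤ (w 0 ^ (q + 1))⁻¹ + c * l := by
    intro l
    induction l with
    | zero => simp
    | succ l ih =>
      have := step l
      push_cast
      constructor <;> linarith
  have hz : 0 < (w 0 ^ (q + 1))⁻¹ := inv_pos.mpr (pow_pos (hpos 0) _)
  refine ⟨a, (w 0 ^ (q + 1))⁻¹ + c, ha, by positivity, fun l hl => ?_⟩
  have hl' : (1 : ℝ) ≤ l := by exact_mod_cast hl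
  have h1 := bound l
  have h2 := mul_le_mul_of_nonneg_left hl' hz.le
  constructor <;> linarith

/-! ### The step relation of two comparable densities -/

/-- Two continuous densities on `[0, r]`, both of order `x ^ N`, whose difference `P - Q` is
positive of order `x ^ M`. -/
structure ComparableDensities (N M : ℕ) (r : ℝ) (P Q : ℝ → ℝ) : Prop where
  pos : 0 < r
  contP : ContinuousOn P (Icc 0 r)
  contQ : ContinuousOn Q (Icc 0 r)
  boundP : ∃ c C : ℝ, 0 < c ∧ 0 < C ∧ ∀ x ∈ Icc 0 r, c * x ^ N ≤ P x ∧ P x ≤ C * x ^ N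
  boundQ : ∃ c : ℝ, 0 < c ∧ ∀ x ∈ Icc 0 r, c * x ^ N ≤ Q x
  boundSub : ∃ c C : ℝ, 0 < c ∧ 0 < C ∧
    ∀ x ∈ Icc 0 r, c * x ^ M ≤ P x - Q x ∧ P x - Q x ≤ C * x ^ M

theorem integral_const_mul_pow (c u v : ℝ) (N : ℕ) :
    ∫ x in u..v, c * x ^ N = c / (N + 1) * (v ^ (N + 1) - u ^ (N + 1)) := by
  rw [intervalIntegral.integral_const_mul, integral_pow]
  ring

theorem le_integral_of_const_mul_pow_le {f : ℝ → ℝ} {c u v : ℝ} {N : ℕ} (huv : u ≤ v)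
    (hf : ContinuousOn f (Icc u v)) (h : ∀ x ∈ Icc u v, c * x ^ N ≤ f x) :
    c / (N + 1) * (v ^ (N + 1) - u ^ (N + 1)) ≤ ∫ x in u..v, f x := by
  rw [← integral_const_mul_pow]
  exact intervalIntegral.integral_mono_on huv
    (Continuous.intervalIntegrable (by fun_prop) _ _) (hf.intervalIntegrable_of_Icc huv) h

theorem integral_le_of_le_const_mul_pow {f : ℝ → ℝ} {c u v : ℝ} {N : ℕ} (huv : u ≤ v)
    (hf : ContinuousOn f (Icc u v)) (h : ∀ x ∈ Icc u v, f x ≤ c * x ^ N) :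
    ∫ x in u..v, f x ≤ c / (N + 1) * (v ^ (N + 1) - u ^ (N + 1)) := by
  rw [← integral_const_mul_pow]
  exact intervalIntegral.integral_mono_on huv (hf.intervalIntegrable_of_Icc huv)
    (Continuous.intervalIntegrable (by fun_prop) _ _) h

namespace ComparableDensities

variable {N M : ℕ} {r : ℝ} {P Q : ℝ → ℝ}

theorem mono (H : ComparableDensities N M r P Q) {r' : ℝ} (h0 : 0 < r') (hr : r' ≤ r) :
    ComparableDensities N M r' P Q := by
  have hsub : Icc 0 r' ⊆ Icc 0 r := Icc_subset_Icc_right hr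
  obtain ⟨c, C, h1, h2, h3⟩ := H.boundP
  obtain ⟨c', h1', h3'⟩ := H.boundQ
  obtain ⟨d, D, g1, g2, g3⟩ := H.boundSub
  exact ⟨h0, H.contP.mono hsub, H.contQ.mono hsub, ⟨c, C, h1, h2, fun x hx => h3 x (hsub hx)⟩,
    ⟨c', h1', fun x hx => h3' x (hsub hx)⟩, ⟨d, D, g1, g2, fun x hx => g3 x (hsub hx)⟩⟩

theorem integral_sub_integral (H : ComparableDensities N M r P Q) {w : ℝ} (hw : w ∈ Icc 0 r) :
    (∫ x in (0)..w, P x) - ∫ x in (0)..w, Q x = ∫ x in (0)..w, (P x - Q x) := by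
  have hsub : Icc 0 w ⊆ Icc 0 r := Icc_subset_Icc_right hw.2
  exact (intervalIntegral.integral_sub
    ((H.contP.mono hsub).intervalIntegrable_of_Icc hw.1)
    ((H.contQ.mono hsub).intervalIntegrable_of_Icc hw.1)).symm

theorem sub_integral_eq (H : ComparableDensities N M r P Q) {v w : ℝ} (hv : v ∈ Icc 0 r)
    (hw : w ∈ Icc 0 r) :
    (∫ x in (0)..w, P x) - ∫ x in (0)..v, P x = ∫ x in v..w, P x :=
  intervalIntegral.integral_interval_sub_left
    ((H.contP.mono (Icc_subset_Icc_right hw.2)).intervalIntegrable_of_Icc hw.1)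
    ((H.contP.mono (Icc_subset_Icc_right hv.2)).intervalIntegrable_of_Icc hv.1)

theorem integral_lt_integral (H : ComparableDensities N M r P Q) {w : ℝ} (hw : w ∈ Ioc 0 r) :
    ∫ x in (0)..w, Q x < ∫ x in (0)..w, P x := by
  obtain ⟨c, C, hc, -, h⟩ := H.boundSub
  have hsub : Icc 0 w ⊆ Icc 0 r := Icc_subset_Icc_right hw.2
  have h1 := le_integral_of_const_mul_pow_le hw.1.le ((H.contP.sub H.contQ).mono hsub)
    fun x hx => (h x (hsub hx)).1
  have h2 := H.integral_sub_integral ⟨hw.1.le, hw.2⟩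
  have h3 : 0 < c / (M + 1) * (w ^ (M + 1) - 0 ^ (M + 1)) := by
    have := hw.1
    rw [zero_pow (by omega), sub_zero]
    positivity
  simp only [Pi.sub_apply] at h1
  linarith

theorem integral_strictMonoOn (H : ComparableDensities N M r P Q) :
    StrictMonoOn (fun w => ∫ x in (0)..w, P x) (Icc 0 r) := by
  intro v hv w hw hvw
  obtain ⟨c, C, hc, -, h⟩ := H.boundP
  have hsub : Icc v w ⊆ Icc 0 r := Icc_subset_Icc hv.1 hw.2
  have h1 := le_integral_of_const_mul_pow_le hvw.le (H.contP.mono hsub)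
    fun x hx => (h x (hsub hx)).1
  have h2 := H.sub_integral_eq hv hw
  have h3 : 0 < c / (N + 1) * (w ^ (N + 1) - v ^ (N + 1)) := by
    have := pow_lt_pow_left₀ hvw hv.1 (by omega : N + 1 ≠ 0)
    have := sub_pos.mpr this
    positivity
  simp only
  linarith

theorem integral_continuousOn (H : ComparableDensities N M r P Q) :
    ContinuousOn (fun w => ∫ x in (0)..w, P x) (Icc 0 r) := by
  have := intervalIntegral.continuousOn_primitive_interval (μ := volume) (a := 0) (b := r)
    (f := P) (by rw [uIcc_of_le H.pos.le]; exact H.contP.integrableOn_Icc)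
  rwa [uIcc_of_le H.pos.le] at this

/-- Since 0 < ∫₀^w Q < ∫₀^w P, the intermediate value theorem gives v in (0, w); strict monotonicity
of the primitive of P gives uniqueness on the whole of (0, r). -/
theorem existsUnique_step (H : ComparableDensities N M r P Q) {w : ℝ} (hw : w ∈ Ioo 0 r) :
    ∃! v, v ∈ Ioo 0 r ∧ ∫ x in (0)..v, P x = ∫ x in (0)..w, Q x := by
  obtain ⟨c, hc, h⟩ := H.boundQ
  have hsub : Icc 0 w ⊆ Icc 0 r := Icc_subset_Icc_right hw.2.le
  have hQpos : 0 < ∫ x in (0)..w, Q x := by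
    have h1 := le_integral_of_const_mul_pow_le hw.1.le (H.contQ.mono hsub)
      fun x hx => h x (hsub hx)
    refine lt_of_lt_of_le ?_ h1
    have := hw.1
    rw [zero_pow (by omega), sub_zero]
    positivity
  have hlt := H.integral_lt_integral ⟨hw.1, hw.2.le⟩
  obtain ⟨v, hv, hveq⟩ := intermediate_value_Ioo hw.1.le (H.integral_continuousOn.mono hsub)
    ⟨by simpa using hQpos, hlt⟩
  refine ⟨v, ⟨⟨hv.1, hv.2.trans hw.2⟩, hveq⟩, fun u ⟨hu, hueq⟩ => ?_⟩
  exact H.integral_strictMonoOn.injOn (Ioo_subset_Icc_self hu)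
    ⟨hv.1.le, (hv.2.trans hw.2).le⟩ (hueq.trans hveq.symm)

theorem step_lt (H : ComparableDensities N M r P Q) {v w : ℝ} (hv : v ∈ Ioo 0 r)
    (hw : w ∈ Ioo 0 r) (h : ∫ x in (0)..v, P x = ∫ x in (0)..w, Q x) : v < w := by
  have := H.integral_lt_integral ⟨hw.1, hw.2.le⟩
  rw [← h] at this
  exact (H.integral_strictMonoOn.lt_iff_lt (Ioo_subset_Icc_self hv)
    (Ioo_subset_Icc_self hw)).mp this

/-- The step relation is equivalent to ∫_v^w P = ∫₀^w (P - Q). Integrating the bounds x^N for P and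
x^M for P - Q compares the two sides. -/
theorem exists_step_bounds (H : ComparableDensities N M r P Q) :
    ∃ a b : ℝ, 0 < a ∧ 0 < b ∧ ∀ v ∈ Ioo 0 r, ∀ w ∈ Ioo 0 r,
      ∫ x in (0)..v, P x = ∫ x in (0)..w, Q x →
      a * w ^ (M + 1) ≤ w ^ (N + 1) - v ^ (N + 1) ∧
        w ^ (N + 1) - v ^ (N + 1) ≤ b * w ^ (M + 1) := by
  obtain ⟨c, C, hc, hC, hP⟩ := H.boundP
  obtain ⟨d, D, hd, hD, hPQ⟩ := H.boundSub
  refine ⟨d / (M + 1) / (C / (N + 1)), D / (M + 1) / (c / (N + 1)), by positivity, by positivity,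
    fun v hv w hw h => ?_⟩
  have hvw := H.step_lt hv hw h
  have hsub : Icc 0 w ⊆ Icc 0 r := Icc_subset_Icc_right hw.2.le
  have hsub' : Icc v w ⊆ Icc 0 r := Icc_subset_Icc hv.1.le hw.2.le
  have e1 := H.integral_sub_integral (Ioo_subset_Icc_self hw)
  have e2 := H.sub_integral_eq (Ioo_subset_Icc_self hv) (Ioo_subset_Icc_self hw)
  have g1 := le_integral_of_const_mul_pow_le hw.1.le ((H.contP.sub H.contQ).mono hsub)
    fun x hx => (hPQ x (hsub hx)).1
  have g2 := integral_le_of_le_const_mul_pow hw.1.le ((H.contP.sub H.contQ).mono hsub)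
    fun x hx => (hPQ x (hsub hx)).2
  have g3 := le_integral_of_const_mul_pow_le hvw.le (H.contP.mono hsub')
    fun x hx => (hP x (hsub' hx)).1
  have g4 := integral_le_of_le_const_mul_pow hvw.le (H.contP.mono hsub')
    fun x hx => (hP x (hsub' hx)).2
  simp only [Pi.sub_apply] at g1 g2
  rw [zero_pow (by omega), sub_zero] at g1 g2
  constructor
  · rw [div_mul_eq_mul_div, div_le_iff₀ (by positivity)]
    linarith
  · rw [div_mul_eq_mul_div, le_div_iff₀ (by positivity)]
    linarith

/-- On a small enough interval every orbit of the step relation decreases with the same power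
law. -/
theorem exists_orbit_bounds {q : ℕ} (H : ComparableDensities N (N + q + 1) r P Q) :
    ∃ r' : ℝ, 0 < r' ∧ r' ≤ r ∧ ∀ w : ℕ → ℝ, (∀ l, w l ∈ Ioo 0 r') →
      (∀ l, ∫ x in (0)..w (l + 1), P x = ∫ x in (0)..w l, Q x) →
      StrictAnti w ∧
      (∃ A B : ℝ, 0 < A ∧ 0 < B ∧ ∀ l : ℕ, 1 ≤ l →
        A * l ≤ (w l ^ (q + 1))⁻¹ ∧ (w l ^ (q + 1))⁻¹ ≤ B * l) ∧
      ∃ a b : ℝ, 0 < a ∧ 0 < b ∧ ∀ l, a * w l ^ (N + q + 2) ≤ w l ^ (N + 1) - w (l + 1) ^ (N + 1) ∧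
        w l ^ (N + 1) - w (l + 1) ^ (N + 1) ≤ b * w l ^ (N + q + 2) := by
  obtain ⟨a, b, ha, hb, hab⟩ := H.exists_step_bounds
  -- The radius depends only on b, not on the orbit, so one section serves all initial points.
  have hev : ∀ᶠ s in 𝓝[>] (0 : ℝ), b * s ^ (q + 1) ≤ 1 / 2 := by
    have h1 : Tendsto (fun s : ℝ => b * s ^ (q + 1)) (𝓝 0) (𝓝 (b * 0 ^ (q + 1))) :=
      Continuous.tendsto (by fun_prop) 0
    rw [zero_pow (by omega), mul_zero] at h1
    exact nhdsWithin_le_nhds (h1.eventually (Iic_mem_nhds (by norm_num : (0 : ℝ) < 1 / 2)))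
  obtain ⟨r', hsmall, hr0, hr⟩ := (hev.and (Ioc_mem_nhdsGT H.pos)).exists
  refine ⟨r', hr0, hr, fun w hw hstep => ?_⟩
  have hw' : ∀ l, w l ∈ Ioo 0 r := fun l => ⟨(hw l).1, (hw l).2.trans_le hr⟩
  have hanti : StrictAnti w :=
    strictAnti_nat_of_succ_lt fun l => H.step_lt (hw' (l + 1)) (hw' l) (hstep l)
  have hgap := fun l => hab _ (hw' (l + 1)) _ (hw' l) (hstep l)
  refine ⟨hanti, ?_, a, b, ha, hb, hgap⟩
  -- Passing from gaps of w^(N+1) to gaps of w divides by w^N; only the lower constant loses the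
  -- factor N + 1.
  apply inv_pow_linear_growth (a := a / (N + 1)) (b := b) (by positivity) hb
    (fun l => (hw l).1) hanti.antitone
  · intro l
    have h0 : 0 < w l := (hw l).1
    have h1 := pow_sub_pow_le_mul_sub (hw (l + 1)).1.le (hanti (Nat.lt_succ_self l)).le N
    have h2 := (hgap l).1.trans h1
    rw [div_mul_eq_mul_div, div_le_iff₀ (by positivity)]
    refine le_of_mul_le_mul_right ?_ (pow_pos h0 N)
    calc a * w l ^ (q + 2) * w l ^ N = a * w l ^ (N + q + 1 + 1) := by ring
      _ ≤ _ := h2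
      _ = _ := by ring
  · intro l
    have h0 : 0 < w l := (hw l).1
    have h1 := sub_mul_pow_le_pow_sub_pow (hw (l + 1)).1.le (hanti (Nat.lt_succ_self l)).le N
    refine le_of_mul_le_mul_right ?_ (pow_pos h0 N)
    calc _ ≤ _ := h1
      _ ≤ _ := (hgap l).2
      _ = _ := by ring
  · exact (mul_le_mul_of_nonneg_left (pow_le_pow_left₀ (hw 0).1.le (hw 0).2.le _) hb.le).trans
      hsmall

end ComparableDensities

/-- The relation is the graph of a self-map of S, so the orbit is the sequence of its iterates. -/
theorem existsUnique_orbit {α : Type*} {S : Set α} {R : α → α → Prop}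
    (h : ∀ t ∈ S, ∃! u, u ∈ S ∧ R t u) {y₀ : α} (hy₀ : y₀ ∈ S) :
    ∃! y : ℕ → α, y 0 = y₀ ∧ (∀ l, y l ∈ S) ∧ ∀ l, R (y l) (y (l + 1)) := by
  choose! f hf hfu using h
  have hmem : ∀ l, f^[l] y₀ ∈ S := by
    intro l
    induction l with
    | zero => exact hy₀
    | succ l ih =>
      rw [Function.iterate_succ_apply']
      exact (hf _ ih).1
  refine ⟨fun l => f^[l] y₀, ⟨rfl, hmem, fun l => ?_⟩, ?_⟩
  · simp only [Function.iterate_succ_apply']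
    exact (hf _ (hmem l)).2
  · rintro y ⟨h0, h1, h2⟩
    funext l
    induction l with
    | zero => exact h0
    | succ l ih =>
      simp only [Function.iterate_succ_apply']
      rw [← ih]
      exact hfu _ (h1 l) _ ⟨h1 (l + 1), h2 l⟩

/-! ### Taylor expansion of the even part -/

theorem taylor_isLittleO_nhds {g : ℝ → ℝ} (hg : ContDiffAt ℝ ∞ g 0) (N : ℕ) :
    (fun x => g x - ∑ i ∈ Finset.range (N + 1), iteratedDeriv i g 0 / (i.factorial : ℝ) * x ^ i)
      =o[𝓝 0] fun x => x ^ N := by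
  have hgN : ContDiffAt ℝ N g 0 := hg.of_le (mod_cast le_top)
  obtain ⟨u, hu, hgu⟩ := hgN.contDiffOn le_rfl (by simp)
  obtain ⟨r, hr, hsub⟩ := Metric.mem_nhds_iff.mp (by simpa using hu)
  have h := taylor_isLittleO (convex_ball (0 : ℝ) r) (Metric.mem_ball_self hr) (hgu.mono hsub)
  rw [nhdsWithin_eq_nhds.mpr (Metric.ball_mem_nhds _ hr)] at h
  simp only [sub_zero] at h
  refine h.congr_left fun x => ?_
  rw [taylor_within_apply]
  congr 1
  refine Finset.sum_congr rfl fun i _ => ?_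
  rw [iteratedDerivWithin_eq_iteratedDeriv Metric.isOpen_ball.uniqueDiffOn
    (hg.of_le (mod_cast le_top)) (Metric.mem_ball_self hr), sub_zero, smul_eq_mul]
  ring

theorem sum_mul_pow_add_sum_mul_neg_pow (c : ℕ → ℝ) (x : ℝ) (J : ℕ) :
    ∑ i ∈ Finset.range (2 * J + 1), c i * x ^ i + ∑ i ∈ Finset.range (2 * J + 1), c i * (-x) ^ i =
      ∑ j ∈ Finset.range (J + 1), 2 * c (2 * j) * x ^ (2 * j) := by
  induction J with
  | zero => simp; ring
  | succ J ih =>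
    rw [Finset.sum_range_succ _ (J + 1), ← ih, show 2 * (J + 1) + 1 = 2 * J + 1 + 1 + 1 by ring]
    simp only [Finset.sum_range_succ _ (2 * J + 1 + 1), Finset.sum_range_succ _ (2 * J + 1)]
    have h1 : (-x) ^ (2 * J + 1) = -x ^ (2 * J + 1) := Odd.neg_pow ⟨J, rfl⟩ x
    have h2 : (-x) ^ (2 * J + 1 + 1) = x ^ (2 * J + 1 + 1) := Even.neg_pow ⟨J + 1, by ring⟩ x
    rw [h1, h2, show 2 * (J + 1) = 2 * J + 1 + 1 by ring]
    ring

theorem even_part_isLittleO {g : ℝ → ℝ} (hg : ContDiffAt ℝ ∞ g 0) (J : ℕ) :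
    (fun x => g x + g (-x) - ∑ j ∈ Finset.range (J + 1),
      2 * (iteratedDeriv (2 * j) g 0 / ((2 * j).factorial : ℝ)) * x ^ (2 * j))
      =o[𝓝 0] fun x => x ^ (2 * J) := by
  have h1 := taylor_isLittleO_nhds hg (2 * J)
  have hneg : Tendsto (fun x : ℝ => -x) (𝓝 0) (𝓝 0) := by
    simpa using (continuous_neg (G := ℝ)).tendsto 0
  have h2 := h1.comp_tendsto hneg
  simp only [Function.comp_def, Even.neg_pow (even_two_mul J)] at h2
  refine (h1.add h2).congr_left fun x => ?_
  rw [← sum_mul_pow_add_sum_mul_neg_pow (fun i => iteratedDeriv i g 0 / (i.factorial : ℝ))]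
  ring

/-- If all even Taylor coefficients between `2n` and `2k` vanish and the even part of `g` is
`O(x ^ (2n))`, then twice the even part of `g` is `2 c x ^ (2k)` to leading order. -/
theorem even_part_sub_isLittleO {g : ℝ → ℝ} {n k : ℕ} (hg : ContDiffAt ℝ ∞ g 0)
    (heven : (fun x => g x + g (-x)) =O[𝓝 0] fun x : ℝ => x ^ (2 * n))
    (hzero : ∀ j, n ≤ j → j < k → iteratedDeriv (2 * j) g 0 / ((2 * j).factorial : ℝ) = 0) :
    (fun x => g x + g (-x) -
      2 * (iteratedDeriv (2 * k) g 0 / ((2 * k).factorial : ℝ)) * x ^ (2 * k))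
      =o[𝓝 0] fun x => x ^ (2 * k) := by
  -- `hzero` is silent about j < n. There the even part is o(x^(2j)), and once the lower
  -- coefficients vanish this forces the coefficient of x^(2j) to vanish too.
  have hall : ∀ j < k, iteratedDeriv (2 * j) g 0 / ((2 * j).factorial : ℝ) = 0 := by
    intro j
    induction j using Nat.strong_induction_on with
    | _ j ih =>
      intro hj
      by_cases hnj : n ≤ j
      · exact hzero j hnj hj
      · have h1 := even_part_isLittleO hg j
        have h2 : (fun x => g x + g (-x)) =o[𝓝 0] fun x : ℝ => x ^ (2 * j) :=
          heven.trans_isLittleO (isLittleO_pow_pow (by omega))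
        have h3 := h2.sub h1
        have h4 : (fun x : ℝ => 2 * (iteratedDeriv (2 * j) g 0 / ((2 * j).factorial : ℝ)) *
            x ^ (2 * j)) =o[𝓝 0] fun x : ℝ => x ^ (2 * j) := by
          refine h3.congr_left fun x => ?_
          rw [Finset.sum_range_succ, Finset.sum_eq_zero fun i hi => ?_]
          · ring
          · have hi' := Finset.mem_range.mp hi
            rw [ih i hi' (hi'.trans hj)]
            ring
        by_contra hne
        have h5 := (isLittleO_const_mul_left_iff (mul_ne_zero two_ne_zero hne)).mp h4
        refine isLittleO_irrefl ?_ (h5.mono (nhdsWithin_le_nhds (s := {0}ᶜ)))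
        refine Eventually.frequently ?_
        filter_upwards [self_mem_nhdsWithin] with x hx
        exact pow_ne_zero _ hx
  refine (even_part_isLittleO hg k).congr_left fun x => ?_
  rw [Finset.sum_range_succ, Finset.sum_eq_zero fun i hi => ?_, zero_add]
  rw [hall i (Finset.mem_range.mp hi)]
  ring

/-! ### Densities given as quotients -/

/-- Only the origin is delicate: the numerator vanishes there, so the quotient takes the value 0
even if u(0) = 0, and this is the limit because the quotient is at most 2a·x^N. -/
theorem continuousOn_sq_pow_div {u : ℝ → ℝ} {a r : ℝ} {N : ℕ} (hN : N ≠ 0) (ha : 0 < a)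
    (hu : ContinuousOn u (Icc 0 r)) (hlo : ∀ x ∈ Ioc 0 r, x ^ N / 2 ≤ u x) :
    ContinuousOn (fun x => a * (x ^ N) ^ 2 / u x) (Icc 0 r) := by
  intro x hx
  rcases hx.1.eq_or_lt with h0 | h0
  · subst h0
    have hlim : Tendsto (fun x : ℝ => 2 * a * x ^ N) (𝓝[Icc 0 r] 0) (𝓝 0) := by
      have h1 : Tendsto (fun x : ℝ => 2 * a * x ^ N) (𝓝 0) (𝓝 (2 * a * 0 ^ N)) :=
        Continuous.tendsto (by fun_prop) 0
      rw [zero_pow hN, mul_zero] at h1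
      exact h1.mono_left nhdsWithin_le_nhds
    simp only [ContinuousWithinAt, zero_pow hN, zero_pow two_ne_zero, mul_zero, zero_div]
    refine squeeze_zero' ?_ ?_ hlim
    · filter_upwards [self_mem_nhdsWithin] with x hx
      rcases hx.1.eq_or_lt with h | h
      · simp [← h, zero_pow hN]
      · have := hlo x ⟨h, hx.2⟩
        have : 0 < u x := lt_of_lt_of_le (by positivity) this
        positivity
    · filter_upwards [self_mem_nhdsWithin] with x hx
      rcases hx.1.eq_or_lt with h | h
      · simp [← h, zero_pow hN]
      · have h1 := hlo x ⟨h, hx.2⟩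
        have h2 : 0 < u x := lt_of_lt_of_le (by positivity) h1
        have h3 : 0 < x ^ N := by positivity
        rw [div_le_iff₀ h2]
        nlinarith [mul_le_mul_of_nonneg_left h1 (mul_pos ha h3).le]
  · have h2 : 0 < u x := lt_of_lt_of_le (by positivity) (hlo x ⟨h0, hx.2⟩)
    exact ContinuousWithinAt.div (Continuous.continuousWithinAt (by fun_prop)) (hu x hx) h2.ne'

/-- The difference of the quotients is a·x^(2N)(v - u)/(uv), and uv has order x^(2N); so it inherits
the order x^M of v - u. -/
theorem ComparableDensities.of_quotients {u v : ℝ → ℝ} {a c r : ℝ} {N M : ℕ} (hN : N ≠ 0)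
    (hM : M ≠ 0) (ha : 0 < a) (hc : 0 < c) (hr : 0 < r)
    (hu : ContinuousOn u (Icc 0 r)) (hv : ContinuousOn v (Icc 0 r))
    (hub : ∀ x ∈ Ioc 0 r, x ^ N / 2 ≤ u x ∧ u x ≤ 2 * x ^ N)
    (hvb : ∀ x ∈ Ioc 0 r, x ^ N / 2 ≤ v x ∧ v x ≤ 2 * x ^ N)
    (huv : ∀ x ∈ Ioc 0 r, c * x ^ M ≤ v x - u x ∧ v x - u x ≤ 3 * c * x ^ M) :
    ComparableDensities N M r (fun x => a * (x ^ N) ^ 2 / u x)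
      (fun x => a * (x ^ N) ^ 2 / v x) := by
  have key : ∀ z X : ℝ, 0 < X → X / 2 ≤ z → z ≤ 2 * X →
      a / 2 * X ≤ a * X ^ 2 / z ∧ a * X ^ 2 / z ≤ 2 * a * X := by
    intro z X hX h1 h2
    have hz : 0 < z := by linarith
    have haX : 0 < a * X := by positivity
    rw [le_div_iff₀ hz, div_le_iff₀ hz]
    constructor
    · nlinarith [mul_le_mul_of_nonneg_left h2 haX.le]
    · nlinarith [mul_le_mul_of_nonneg_left h1 haX.le]
  refine ⟨hr, continuousOn_sq_pow_div hN ha hu fun x hx => (hub x hx).1,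
    continuousOn_sq_pow_div hN ha hv fun x hx => (hvb x hx).1,
    ⟨a / 2, 2 * a, by positivity, by positivity, fun x hx => ?_⟩,
    ⟨a / 2, by positivity, fun x hx => ?_⟩,
    ⟨a * c / 4, 12 * a * c, by positivity, by positivity, fun x hx => ?_⟩⟩
  · rcases hx.1.eq_or_lt with h | h
    · simp [← h, zero_pow hN]
    · have := hub x ⟨h, hx.2⟩
      exact key _ _ (by positivity) this.1 this.2
  · rcases hx.1.eq_or_lt with h | h
    · simp [← h, zero_pow hN]
    · have := hvb x ⟨h, hx.2⟩
      exact (key _ _ (by positivity) this.1 this.2).1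
  · rcases hx.1.eq_or_lt with h | h
    · simp [← h, zero_pow hN, zero_pow hM]
    · obtain ⟨u1, u2⟩ := hub x ⟨h, hx.2⟩
      obtain ⟨v1, v2⟩ := hvb x ⟨h, hx.2⟩
      obtain ⟨d1, d2⟩ := huv x ⟨h, hx.2⟩
      have hX : 0 < x ^ N := by positivity
      have hu0 : 0 < u x := by linarith
      have hv0 : 0 < v x := by linarith
      have hXM : 0 < x ^ M := by positivity
      have e : a * (x ^ N) ^ 2 / u x - a * (x ^ N) ^ 2 / v x =
          a * (x ^ N) ^ 2 * (v x - u x) / (u x * v x) := by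
        field_simp
      have p1 : u x * v x ≤ 2 * x ^ N * (2 * x ^ N) := by gcongr
      have p2 : x ^ N / 2 * (x ^ N / 2) ≤ u x * v x := by gcongr
      rw [e, le_div_iff₀ (by positivity), div_le_iff₀ (by positivity)]
      constructor
      · calc a * c / 4 * x ^ M * (u x * v x) ≤ a * c / 4 * x ^ M * (2 * x ^ N * (2 * x ^ N)) := by
              gcongr
          _ = a * (x ^ N) ^ 2 * (c * x ^ M) := by ring
          _ ≤ _ := by gcongr
      · calc a * (x ^ N) ^ 2 * (v x - u x) ≤ a * (x ^ N) ^ 2 * (3 * c * x ^ M) := by gcongr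
          _ = 12 * a * c * x ^ M * (x ^ N / 2 * (x ^ N / 2)) := by ring
          _ ≤ _ := by gcongr

/-! ### The slow divergence integrals as comparable densities -/

namespace LienardFamily

variable {n m k : ℕ} (X : LienardFamily n m)

theorem tendsto_slice :
    Tendsto (fun x : ℝ => (x, (0 : EuclideanSpace ℝ (Fin m)))) (𝓝 0) (𝓝 0) :=
  Continuous.tendsto' (by fun_prop) _ _ rfl

theorem eventually_contDiffAt_slice :
    ∀ᶠ x in 𝓝 (0 : ℝ), ContDiffAt ℝ ∞ (fun x => X.F (x, 0)) x := by
  filter_upwards [tendsto_slice.eventually X.smooth_F] with x hx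
  exact ContDiffAt.comp x hx (by fun_prop)

theorem slice_add_pow_isBigO :
    (fun x : ℝ => X.F (x, 0) + x ^ (2 * n - 1)) =O[𝓝 0] fun x : ℝ => x ^ (2 * n) :=
  X.leading_F.comp_tendsto tendsto_slice

/-- The leading term -x^(2n-1) is odd and cancels in F(x,0) + F(-x,0). -/
theorem even_part_isBigO (hn : 1 ≤ n) :
    (fun x : ℝ => X.F (x, 0) + X.F (-x, 0)) =O[𝓝 0] fun x : ℝ => x ^ (2 * n) := by
  have h1 := X.slice_add_pow_isBigO
  have hneg : Tendsto (fun x : ℝ => -x) (𝓝 0) (𝓝 0) := by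
    simpa using (continuous_neg (G := ℝ)).tendsto 0
  have h2 := h1.comp_tendsto hneg
  have hodd : Odd (2 * n - 1) := ⟨n - 1, by omega⟩
  simp only [Function.comp_def, Even.neg_pow (even_two_mul n), hodd.neg_pow] at h2
  exact (h1.add h2).congr_left fun x => by ring

theorem eventually_slice_near_pow (hn : 1 ≤ n) :
    ∀ᶠ x in 𝓝 (0 : ℝ), |X.F (x, 0) + x ^ (2 * n - 1)| ≤ 1 / 2 * |x| ^ (2 * n - 1) := by
  have h := (X.slice_add_pow_isBigO.trans_isLittleO
    (isLittleO_pow_pow (show 2 * n - 1 < 2 * n by omega))).bound (by norm_num : (0 : ℝ) < 1 / 2)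
  simpa [Real.norm_eq_abs, abs_pow] using h

theorem slowDivIntegrand_eq (x : ℝ) :
    X.slowDivIntegrand 0 x = 4 * (n : ℝ) ^ 2 * (x ^ (2 * n - 1)) ^ 2 / (-X.F (x, 0)) := by
  rw [slowDivIntegrand, div_neg, neg_div]
  ring

theorem neg_slowDivIntegrand_neg_eq (x : ℝ) :
    -X.slowDivIntegrand 0 (-x) = 4 * (n : ℝ) ^ 2 * (x ^ (2 * n - 1)) ^ 2 / X.F (-x, 0) := by
  have h : ((-x) ^ (2 * n - 1)) ^ 2 = (x ^ (2 * n - 1)) ^ 2 := by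
    rw [← pow_mul, ← pow_mul, mul_comm, pow_mul, pow_mul, neg_sq]
  rw [slowDivIntegrand, neg_div, neg_neg, mul_pow, h]
  ring

/-- At a contact point of finite codimension the integrands over the two branches are comparable
densities, in an order given by the sign of the first nonzero even Taylor coefficient. -/
theorem exists_comparableDensities (hn : 1 ≤ n) (hk : X.HasCodimension k) :
    ∃ r, ComparableDensities (2 * n - 1) (2 * k) r (X.slowDivIntegrand 0)
        (fun x => -X.slowDivIntegrand 0 (-x)) ∨
      ComparableDensities (2 * n - 1) (2 * k) r (fun x => -X.slowDivIntegrand 0 (-x))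
        (X.slowDivIntegrand 0) := by
  obtain ⟨⟨hnk, hc⟩, hmin⟩ := hk
  set c := X.taylorCoeff (2 * k) 0 with hcdef
  have hzero : ∀ j, n ≤ j → j < k → X.taylorCoeff (2 * j) 0 = 0 := by
    intro j h1 h2
    by_contra h
    exact absurd (hmin ⟨h1, h⟩) (not_le.mpr h2)
  have hO := even_part_sub_isLittleO X.eventually_contDiffAt_slice.self_of_nhds
    (X.even_part_isBigO hn) hzero
  -- An error of |c|x^(2k) is half of the leading term 2c·x^(2k): the sign is kept, with bounds |c|
  -- and 3|c|.
  have hev := hO.bound (abs_pos.mpr hc)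
  have hneg : Tendsto (fun x : ℝ => -x) (𝓝 0) (𝓝 0) := by
    simpa using (continuous_neg (G := ℝ)).tendsto 0
  have hall := ((hev.and (X.eventually_slice_near_pow hn)).and
    (hneg.eventually (X.eventually_slice_near_pow hn))).and
    (X.eventually_contDiffAt_slice.and (hneg.eventually X.eventually_contDiffAt_slice))
  obtain ⟨r', hr', hball⟩ := Metric.eventually_nhds_iff_ball.mp hall
  have hr : 0 < r' / 2 := by linarith
  have hmem : ∀ x ∈ Icc 0 (r' / 2), x ∈ Metric.ball (0 : ℝ) r' := by
    intro x hx
    rw [mem_ball_zero_iff, Real.norm_eq_abs, abs_of_nonneg hx.1]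
    linarith [hx.2]
  have hu : ContinuousOn (fun x => -X.F (x, 0)) (Icc 0 (r' / 2)) := fun x hx =>
    (hball x (hmem x hx)).2.1.continuousAt.neg.continuousWithinAt
  have hv : ContinuousOn (fun x => X.F (-x, 0)) (Icc 0 (r' / 2)) := fun x hx =>
    (ContinuousAt.comp (f := fun x : ℝ => -x) (hball x (hmem x hx)).2.2.continuousAt
      continuous_neg.continuousAt).continuousWithinAt
  have hodd : Odd (2 * n - 1) := ⟨n - 1, by omega⟩
  have hub : ∀ x ∈ Ioc 0 (r' / 2), x ^ (2 * n - 1) / 2 ≤ -X.F (x, 0) ∧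
      -X.F (x, 0) ≤ 2 * x ^ (2 * n - 1) := by
    intro x hx
    have h := (hball x (hmem x (Ioc_subset_Icc_self hx))).1.1.2
    rw [abs_of_pos hx.1, abs_le] at h
    have : 0 < x ^ (2 * n - 1) := pow_pos hx.1 _
    constructor <;> linarith
  have hvb : ∀ x ∈ Ioc 0 (r' / 2), x ^ (2 * n - 1) / 2 ≤ X.F (-x, 0) ∧
      X.F (-x, 0) ≤ 2 * x ^ (2 * n - 1) := by
    intro x hx
    have h := (hball x (hmem x (Ioc_subset_Icc_self hx))).1.2
    rw [abs_neg, abs_of_pos hx.1, hodd.neg_pow, abs_le] at h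
    have : 0 < x ^ (2 * n - 1) := pow_pos hx.1 _
    constructor <;> linarith
  have huv : ∀ x ∈ Ioc 0 (r' / 2), |X.F (x, 0) + X.F (-x, 0) - 2 * c * x ^ (2 * k)| ≤
      |c| * x ^ (2 * k) := by
    intro x hx
    have h := (hball x (hmem x (Ioc_subset_Icc_self hx))).1.1.1
    rwa [Real.norm_eq_abs, Real.norm_eq_abs, abs_of_pos (pow_pos hx.1 (2 * k))] at h
  have e1 : X.slowDivIntegrand 0 =
      fun x => 4 * (n : ℝ) ^ 2 * (x ^ (2 * n - 1)) ^ 2 / (-X.F (x, 0)) :=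
    funext X.slowDivIntegrand_eq
  have e2 : (fun x => -X.slowDivIntegrand 0 (-x)) =
      fun x => 4 * (n : ℝ) ^ 2 * (x ^ (2 * n - 1)) ^ 2 / X.F (-x, 0) :=
    funext X.neg_slowDivIntegrand_neg_eq
  have ha : (0 : ℝ) < 4 * (n : ℝ) ^ 2 := by positivity
  refine ⟨r' / 2, ?_⟩
  rw [e2, e1]
  -- The smaller denominator gives the larger density: -F(x,0) is the smaller one exactly when c >
  -- 0.
  rcases lt_or_gt_of_ne hc with hc0 | hc0
  · right
    refine ComparableDensities.of_quotients (c := -c) (by omega) (by omega) ha (by linarith) hr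
      hv hu hvb hub fun x hx => ?_
    have h := huv x hx
    rw [abs_of_neg hc0, abs_le] at h
    constructor <;> linarith
  · left
    refine ComparableDensities.of_quotients (c := c) (by omega) (by omega) ha hc0 hr
      hu hv hub hvb fun x hx => ?_
    have h := huv x hx
    rw [abs_of_pos hc0, abs_le] at h
    constructor <;> linarith

theorem JMinus_eq (y : ℝ) :
    X.JMinus y 0 = -∫ x in (0)..omegaPt n y, X.slowDivIntegrand 0 x :=
  intervalIntegral.integral_symm _ _

/-- The reflection x ↦ -x moves the repelling branch to [0, ω(y)], because α(y) = -ω(y). -/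
theorem JPlus_eq (y : ℝ) :
    X.JPlus y 0 = -∫ x in (0)..omegaPt n y, -X.slowDivIntegrand 0 (-x) := by
  rw [intervalIntegral.integral_neg, neg_neg,
    intervalIntegral.integral_comp_neg (fun x => X.slowDivIntegrand 0 x), neg_zero]
  rfl

end LienardFamily

/-! ### Power laws and dimensions of the orbits -/

theorem seqComparable_of_bounds {a b : ℕ → ℝ} {A B : ℝ} (hA : 0 < A)
    (hb : ∀ l : ℕ, 1 ≤ l → 0 < b l)
    (h : ∀ l : ℕ, 1 ≤ l → A * b l ≤ a l ∧ a l ≤ B * b l) : SeqComparable a b := by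
  refine ⟨A, max B (A + 1), hA, lt_max_of_lt_right (lt_add_one A), fun l hl => ⟨?_, ?_⟩⟩
  · rw [le_div_iff₀ (hb l hl)]
    exact (h l hl).1
  · exact ((div_le_iff₀ (hb l hl)).mpr (h l hl).2).trans (le_max_left _ _)

/-- Write w^p as the power -p/m of w^(-m); the nonpositive exponent exchanges the roles of A and B.
-/
theorem pow_bounds_of_inv_pow_bounds {w A B : ℝ} {m l : ℕ} (hw : 0 < w) (hm : m ≠ 0) (hA : 0 < A)
    (hl : 1 ≤ l) (h : A * l ≤ (w ^ m)⁻¹ ∧ (w ^ m)⁻¹ ≤ B * l) (p : ℕ) :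
    B ^ (-((p : ℝ) / m)) * (l : ℝ) ^ (-((p : ℝ) / m)) ≤ w ^ p ∧
      w ^ p ≤ A ^ (-((p : ℝ) / m)) * (l : ℝ) ^ (-((p : ℝ) / m)) := by
  have hl0 : (0 : ℝ) < l := by exact_mod_cast hl
  have hinv : 0 < (w ^ m)⁻¹ := by positivity
  have hB : 0 < B := pos_of_mul_pos_left (hinv.trans_le h.2) hl0.le
  have hm' : (m : ℝ) ≠ 0 := by exact_mod_cast hm
  have hexp : -((p : ℝ) / m) ≤ 0 := neg_nonpos.mpr (by positivity)
  have hwp : w ^ p = ((w ^ m)⁻¹) ^ (-((p : ℝ) / m)) := by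
    rw [← Real.rpow_natCast w m, ← Real.rpow_neg hw.le, ← Real.rpow_mul hw.le, neg_mul_neg,
      mul_div_cancel₀ _ hm', Real.rpow_natCast]
  rw [hwp, ← Real.mul_rpow hB.le hl0.le, ← Real.mul_rpow hA.le hl0.le]
  exact ⟨Real.rpow_le_rpow_of_nonpos hinv h.2 hexp,
    Real.rpow_le_rpow_of_nonpos (by positivity) h.1 hexp⟩

namespace LienardFamily

variable {n m k : ℕ}

theorem omegaPt_pos {t : ℝ} (ht : 0 < t) : 0 < omegaPt n t := Real.rpow_pos_of_pos ht _

theorem omegaPt_pow (hn : 1 ≤ n) {t : ℝ} (ht : 0 ≤ t) : omegaPt n t ^ (2 * n) = t := by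
  have hn' : (n : ℝ) ≠ 0 := by exact_mod_cast (by omega : n ≠ 0)
  rw [omegaPt, ← Real.rpow_natCast, ← Real.rpow_mul ht]
  push_cast
  rw [one_div_mul_cancel (by simpa using hn'), Real.rpow_one]

theorem omegaPt_of_pow (hn : 1 ≤ n) {x : ℝ} (hx : 0 ≤ x) : omegaPt n (x ^ (2 * n)) = x := by
  have hn' : (n : ℝ) ≠ 0 := by exact_mod_cast (by omega : n ≠ 0)
  rw [omegaPt, ← Real.rpow_natCast, ← Real.rpow_mul hx]
  push_cast
  rw [mul_one_div_cancel (by simpa using hn'), Real.rpow_one]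

theorem omegaPt_mem (hn : 1 ≤ n) {r t : ℝ} (hr : 0 ≤ r) (ht : t ∈ Ioo 0 (r ^ (2 * n))) :
    omegaPt n t ∈ Ioo 0 r := by
  refine ⟨omegaPt_pos ht.1, lt_of_pow_lt_pow_left₀ (2 * n) hr ?_⟩
  rw [omegaPt_pow hn ht.1.le]
  exact ht.2

/-- The orbit in the section `0 < y < δ`, from `y₀`, of the relation which equates the integral of
`P` up to the next point with the integral of `Q` up to the present point. -/
def IsDensityOrbit (n : ℕ) (P Q : ℝ → ℝ) (δ y₀ : ℝ) (y : ℕ → ℝ) : Prop :=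
  y 0 = y₀ ∧ (∀ l, y l ∈ Ioo 0 δ) ∧
    ∀ l, ∫ x in (0)..omegaPt n (y (l + 1)), P x = ∫ x in (0)..omegaPt n (y l), Q x

theorem existsUnique_isDensityOrbit (hn : 1 ≤ n) {N M : ℕ} {r : ℝ} {P Q : ℝ → ℝ}
    (H : ComparableDensities N M r P Q) {y₀ : ℝ} (hy₀ : y₀ ∈ Ioo 0 (r ^ (2 * n))) :
    ∃! y, IsDensityOrbit n P Q (r ^ (2 * n)) y₀ y := by
  refine existsUnique_orbit (S := Ioo 0 (r ^ (2 * n))) (R := fun t u =>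
    ∫ x in (0)..omegaPt n u, P x = ∫ x in (0)..omegaPt n t, Q x) (fun t ht => ?_) hy₀
  obtain ⟨v, ⟨hv, hveq⟩, huniq⟩ := H.existsUnique_step (omegaPt_mem hn H.pos.le ht)
  refine ⟨v ^ (2 * n), ⟨⟨pow_pos hv.1 _, pow_lt_pow_left₀ hv.2 hv.1.le (by omega)⟩, ?_⟩,
    fun u ⟨hu, hueq⟩ => ?_⟩
  · rwa [omegaPt_of_pow hn hv.1.le]
  · rw [← huniq _ ⟨omegaPt_mem hn H.pos.le hu, hueq⟩, omegaPt_pow hn hu.1.le]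

/-- The power laws of the orbits of comparable densities, and the dimensions they entail. -/
theorem exists_forall_isDensityOrbit (hn : 1 ≤ n) (hnk : n ≤ k) {r : ℝ} {P Q : ℝ → ℝ}
    (H : ComparableDensities (2 * n - 1) (2 * k) r P Q) :
    ∃ r', 0 < r' ∧ r' ≤ r ∧ ∀ y₀, ∀ y : ℕ → ℝ, IsDensityOrbit n P Q (r' ^ (2 * n)) y₀ y →
      StrictAnti y ∧ Tendsto y atTop (𝓝 0) ∧
      SeqComparable y
        (fun l => (l : ℝ) ^ (-(2 * (n : ℝ) / (2 * ((k : ℝ) - n) + 1)))) ∧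
      SeqComparable (fun l => y l - y (l + 1))
        (fun l => (l : ℝ) ^ (-((2 * (k : ℝ) + 1) / (2 * ((k : ℝ) - n) + 1)))) ∧
      HasBoxDim (range y) ((2 * ((k : ℝ) - n) + 1) / (2 * (k : ℝ) + 1)) ∧
      IsGeometricChirp (1 / (2 * (n : ℝ))) ((2 * ((k : ℝ) - n) + 1) / (2 * (n : ℝ)))
        (chirp n y) ∧
      upperBoxDim (chirp n y) = (4 * (k : ℝ) - 2 * n + 1) / (2 * (k : ℝ) + 1) := by
  -- With N = 2n - 1, the order 2k of the difference equals N + 2j + 1, the shape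
  -- `exists_orbit_bounds` requires.
  obtain ⟨j, hj⟩ : ∃ j, k = n + j := ⟨k - n, by omega⟩
  have hM : 2 * k = 2 * n - 1 + 2 * j + 1 := by omega
  rw [hM] at H
  obtain ⟨r', hr0, hrr, horb⟩ := H.exists_orbit_bounds
  refine ⟨r', hr0, hrr, fun y₀ y hy => ?_⟩
  obtain ⟨-, hmem, hstep⟩ := hy
  have hpos : ∀ l, 0 < y l := fun l => (hmem l).1
  obtain ⟨hanti, ⟨A, B, hA, hB, hAB⟩, a, b, ha, hb, hab⟩ :=
    horb (fun l => omegaPt n (y l)) (fun l => omegaPt_mem hn hr0.le (hmem l)) hstep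
  set w : ℕ → ℝ := fun l => omegaPt n (y l) with hw
  have hw0 : ∀ l, 0 < w l := fun l => omegaPt_pos (hpos l)
  have hwy : ∀ l, w l ^ (2 * n) = y l := fun l => omegaPt_pow hn (hpos l).le
  rw [show 2 * n - 1 + 2 * j + 2 = 2 * k + 1 by omega, show 2 * n - 1 + 1 = 2 * n by omega] at hab
  have hab' : ∀ l, a * w l ^ (2 * k + 1) ≤ y l - y (l + 1) ∧
      y l - y (l + 1) ≤ b * w l ^ (2 * k + 1) := fun l => by
    have h := hab l
    simp only [omegaPt_pow hn (hpos _).le] at h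
    exact h
  have hn0 : (0 : ℝ) < n := by exact_mod_cast hn
  have hj0 : (0 : ℝ) ≤ j := Nat.cast_nonneg j
  have hkj : (k : ℝ) = n + j := by exact_mod_cast hj
  have hkn : 2 * ((k : ℝ) - n) + 1 = 2 * j + 1 := by rw [hkj]; ring
  rw [hkn]
  -- This q = 2(k-n)+1 is the power for which w^(-q) grows linearly, one more than the parameter 2j
  -- of `exists_orbit_bounds`.
  set q : ℝ := 2 * j + 1 with hq
  have hq0 : 0 < q := by positivity
  have hq1 : 1 ≤ q := by linarith
  have hqcast : ((2 * j + 1 : ℕ) : ℝ) = q := by rw [hq]; push_cast; ring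
  have hnq : 2 * (n : ℝ) / q + 1 = (2 * k + 1) / q := by
    rw [hkj]
    field_simp
    rw [hq]
    ring
  -- The cases p = 2n, 2k+1 and 1 give the levels, the gaps and the interval lengths.
  have hbound : ∀ (p l : ℕ), 1 ≤ l →
      B ^ (-((p : ℝ) / q)) * (l : ℝ) ^ (-((p : ℝ) / q)) ≤ w l ^ p ∧
        w l ^ p ≤ A ^ (-((p : ℝ) / q)) * (l : ℝ) ^ (-((p : ℝ) / q)) := by
    intro p l hl
    rw [← hqcast]
    exact pow_bounds_of_inv_pow_bounds (hw0 l) (by omega) hA hl (hAB l hl) p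
  have hyanti : StrictAnti y := by
    intro i l hil
    rw [← hwy, ← hwy]
    exact pow_lt_pow_left₀ (hanti hil) (hw0 l).le (by omega)
  have hlpos : ∀ (e : ℝ) (l : ℕ), 1 ≤ l → 0 < (l : ℝ) ^ e := fun e l hl =>
    Real.rpow_pos_of_pos (by exact_mod_cast hl) e
  have hyb : ∀ l : ℕ, 1 ≤ l →
      B ^ (-(2 * (n : ℝ) / q)) * (l : ℝ) ^ (-(2 * (n : ℝ) / q)) ≤ y l ∧
        y l ≤ A ^ (-(2 * (n : ℝ) / q)) * (l : ℝ) ^ (-(2 * (n : ℝ) / q)) := by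
    intro l hl
    have := hbound (2 * n) l hl
    rw [hwy] at this
    exact_mod_cast this
  have hgb : ∀ l : ℕ, 1 ≤ l →
      a * B ^ (-((2 * (k : ℝ) + 1) / q)) * (l : ℝ) ^ (-((2 * (k : ℝ) + 1) / q)) ≤
        y l - y (l + 1) ∧
      y l - y (l + 1) ≤
        b * A ^ (-((2 * (k : ℝ) + 1) / q)) * (l : ℝ) ^ (-((2 * (k : ℝ) + 1) / q)) := by
    intro l hl
    have h1 := hbound (2 * k + 1) l hl
    push_cast at h1
    have h2 := hab' l
    have h3 := mul_le_mul_of_nonneg_left h1.1 ha.le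
    have h4 := mul_le_mul_of_nonneg_left h1.2 hb.le
    constructor <;> linarith
  have hwb : ∀ l : ℕ, 1 ≤ l →
      B ^ (-(1 / q)) * (l : ℝ) ^ (-(1 / q)) ≤ w l ∧
        w l ≤ A ^ (-(1 / q)) * (l : ℝ) ^ (-(1 / q)) := by
    intro l hl
    simpa using hbound 1 l hl
  have htend : Tendsto y atTop (𝓝 0) := by
    have h1 : Tendsto (fun l : ℕ => A ^ (-(2 * (n : ℝ) / q)) * (l : ℝ) ^ (-(2 * (n : ℝ) / q)))
        atTop (𝓝 (A ^ (-(2 * (n : ℝ) / q)) * 0)) :=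
      ((tendsto_rpow_neg_atTop (by positivity : 0 < 2 * (n : ℝ) / q)).comp
        tendsto_natCast_atTop_atTop).const_mul _
    rw [mul_zero] at h1
    refine tendsto_of_tendsto_of_tendsto_of_le_of_le' tendsto_const_nhds h1
      (Eventually.of_forall fun l => (hpos l).le) ?_
    filter_upwards [eventually_ge_atTop 1] with l hl
    exact (hyb l hl).2
  have hyc : SeqComparable y (fun l => (l : ℝ) ^ (-(2 * (n : ℝ) / q))) :=
    seqComparable_of_bounds (by positivity) (hlpos _) hyb
  have hgc : SeqComparable (fun l => y l - y (l + 1))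
      (fun l => (l : ℝ) ^ (-((2 * (k : ℝ) + 1) / q))) :=
    seqComparable_of_bounds (by positivity) (hlpos _) hgb
  have hchirp : chirp n y = horizontalIntervals (fun l => -(y l) ^ (1 / (2 * (n : ℝ))))
      (fun l => (y l) ^ (1 / (2 * (n : ℝ)))) y := rfl
  have hgap : ∀ l : ℕ, 1 ≤ l → y l - y (l + 1) ≤
      b * A ^ (-((2 * (k : ℝ) + 1) / q)) * (l : ℝ) ^ (-(2 * (n : ℝ) / q + 1)) := by
    rw [hnq]
    exact fun l hl => (hgb l hl).2
  have hβ : 0 < 2 * (n : ℝ) / q := by positivity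
  have hk0 : (0 : ℝ) < 2 * k + 1 := by positivity
  refine ⟨hyanti, htend, hyc, hgc, ?_, ⟨by positivity, by positivity, _, _, _, hchirp, ?_, hpos,
    hyanti, htend, ?_, ?_, ?_⟩, ?_⟩
  · have := hasBoxDim_range hβ (by positivity) (by positivity) hyanti hpos htend
      (fun l hl => (hyb l hl).1) (fun l hl => (hyb l hl).2) hgap
    rwa [hnq, one_div_div] at this
  · intro l
    have : 0 < (y l) ^ (1 / (2 * (n : ℝ))) := hw0 l
    refine ⟨?_, this.le, ?_⟩ <;> linarith
  · rwa [one_div_div]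
  · rwa [one_div_div, hnq]
  · have he : 1 / (2 * (n : ℝ)) / (q / (2 * n)) = 1 / q := by field_simp
    rw [he]
    refine seqComparable_of_bounds (A := 2 * B ^ (-(1 / q))) (B := 2 * A ^ (-(1 / q)))
      (by positivity) (hlpos _) fun l hl => ?_
    have h1 := hwb l hl
    have h2 : (y l) ^ (1 / (2 * (n : ℝ))) = w l := rfl
    rw [h2]
    constructor <;> linarith
  · have hβσ : 2 * (n : ℝ) / q * (1 / (2 * n)) = 1 / q := by field_simp
    have := (hasBoxDim_horizontalIntervals (σ := 1 / (2 * (n : ℝ))) hβ (by positivity)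
      (by rw [hβσ, div_le_one hq0]; exact hq1) (by positivity) (by positivity) hyanti hpos htend
      (fun l hl => (hyb l hl).1) (fun l hl => (hyb l hl).2) hgap).2
    rw [hchirp, this, hβσ, hnq]
    field_simp
    rw [hkj]
    ring

variable (X : LienardFamily n m)

theorem intervalIntegrable_slowDivIntegrand {t : ℝ}
    (h : IntervalIntegrable (X.slowDivIntegrand 0) volume 0 (omegaPt n t))
    (h' : IntervalIntegrable (fun x => -X.slowDivIntegrand 0 (-x)) volume 0 (omegaPt n t)) :
    IntervalIntegrable (X.slowDivIntegrand 0) volume (alphaPt n t) (omegaPt n t) := by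
  have h1 := (IntervalIntegrable.iff_comp_neg (f := -fun x => -X.slowDivIntegrand 0 (-x))).mp
    (IntervalIntegrable.neg h')
  simp only [Pi.neg_apply, neg_neg, neg_zero] at h1
  exact h1.symm.trans h

theorem isEntryExitOrbit_iff_of_lt {δ y₀ : ℝ} {y : ℕ → ℝ} (hδ : 0 < δ)
    (hsign : ∀ t ∈ Ioo 0 δ, X.JMinus t 0 - X.JPlus t 0 < 0) :
    X.IsEntryExitOrbit δ y₀ y ↔ IsDensityOrbit n (X.slowDivIntegrand 0)
      (fun x => -X.slowDivIntegrand 0 (-x)) δ y₀ y := by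
  -- A sample point of the section excludes the alternative with the opposite sign.
  have hmid : δ / 2 ∈ Ioo 0 δ := ⟨by linarith, by linarith⟩
  constructor
  · rintro ⟨h0, h1, ⟨-, h2⟩ | ⟨h2, -⟩⟩
    · refine ⟨h0, h1, fun l => ?_⟩
      have := h2 l
      rwa [JMinus_eq, JPlus_eq, neg_inj] at this
    · exact absurd (h2 _ hmid) (hsign _ hmid).not_gt
  · rintro ⟨h0, h1, h2⟩
    refine ⟨h0, h1, Or.inl ⟨hsign, fun l => ?_⟩⟩
    rw [JMinus_eq, JPlus_eq, neg_inj]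
    exact h2 l

theorem isEntryExitOrbit_iff_of_gt {δ y₀ : ℝ} {y : ℕ → ℝ} (hδ : 0 < δ)
    (hsign : ∀ t ∈ Ioo 0 δ, 0 < X.JMinus t 0 - X.JPlus t 0) :
    X.IsEntryExitOrbit δ y₀ y ↔ IsDensityOrbit n (fun x => -X.slowDivIntegrand 0 (-x))
      (X.slowDivIntegrand 0) δ y₀ y := by
  have hmid : δ / 2 ∈ Ioo 0 δ := ⟨by linarith, by linarith⟩
  constructor
  · rintro ⟨h0, h1, ⟨h2, -⟩ | ⟨-, h2⟩⟩
    · exact absurd (h2 _ hmid) (hsign _ hmid).not_gt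
    · refine ⟨h0, h1, fun l => ?_⟩
      have := h2 l
      rw [JMinus_eq, JPlus_eq, neg_inj] at this
      exact this.symm
  · rintro ⟨h0, h1, h2⟩
    refine ⟨h0, h1, Or.inr ⟨hsign, fun l => ?_⟩⟩
    rw [JMinus_eq, JPlus_eq, neg_inj]
    exact (h2 l).symm

end LienardFamily

/-! ### The main theorem -/

theorem theorem5p2 (n m k : ℕ) (hn : 1 ≤ n) (X : LienardFamily n m) (hk : X.HasCodimension k) :
    ∃ δ : ℝ, 0 < δ ∧
      (∀ t ∈ Ioo 0 δ, IntervalIntegrable (X.slowDivIntegrand 0) volume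
        (LienardFamily.alphaPt n t) (LienardFamily.omegaPt n t)) ∧
      ∀ y₀ ∈ Ioo 0 δ,
        (∃! y : ℕ → ℝ, X.IsEntryExitOrbit δ y₀ y) ∧
        ∀ y : ℕ → ℝ, X.IsEntryExitOrbit δ y₀ y →
          StrictAnti y ∧ Tendsto y atTop (𝓝 0) ∧
          SeqComparable y
            (fun l => (l : ℝ) ^ (-(2 * (n : ℝ) / (2 * ((k : ℝ) - n) + 1)))) ∧
          SeqComparable (fun l => y l - y (l + 1))
            (fun l => (l : ℝ) ^ (-((2 * (k : ℝ) + 1) / (2 * ((k : ℝ) - n) + 1)))) ∧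
          HasBoxDim (range y) ((2 * ((k : ℝ) - n) + 1) / (2 * (k : ℝ) + 1)) ∧
          (2 * ((k : ℝ) - n) + 1) / (2 * (k : ℝ) + 1) ∈ Ioo (0 : ℝ) 1 ∧
          IsGeometricChirp (1 / (2 * (n : ℝ))) ((2 * ((k : ℝ) - n) + 1) / (2 * (n : ℝ)))
            (LienardFamily.chirp n y) ∧
          upperBoxDim (LienardFamily.chirp n y) =
            (4 * (k : ℝ) - 2 * n + 1) / (2 * (k : ℝ) + 1) ∧
          (4 * (k : ℝ) - 2 * n + 1) / (2 * (k : ℝ) + 1) ∈ Ico (1 : ℝ) 2 := by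

  have hnk : n ≤ k := hk.1.1
  have hn0 : (0 : ℝ) < n := by exact_mod_cast hn
  have hnk' : (n : ℝ) ≤ k := by exact_mod_cast hnk
  have hdim1 : (2 * ((k : ℝ) - n) + 1) / (2 * (k : ℝ) + 1) ∈ Ioo (0 : ℝ) 1 := by
    constructor
    · apply div_pos <;> linarith
    · rw [div_lt_one] <;> linarith
  have hdim2 : (4 * (k : ℝ) - 2 * n + 1) / (2 * (k : ℝ) + 1) ∈ Ico (1 : ℝ) 2 := by
    constructor
    · rw [one_le_div] <;> linarith
    · rw [div_lt_iff₀] <;> linarith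
  have hint : ∀ {P Q : ℝ → ℝ} {r t : ℝ}, ComparableDensities (2 * n - 1) (2 * k) r P Q →
      t ∈ Ioo 0 (r ^ (2 * n)) →
      IntervalIntegrable P volume 0 (LienardFamily.omegaPt n t) ∧
        IntervalIntegrable Q volume 0 (LienardFamily.omegaPt n t) := by
    intro P Q r t H ht
    have hw := LienardFamily.omegaPt_mem hn H.pos.le ht
    have hsub : Icc 0 (LienardFamily.omegaPt n t) ⊆ Icc 0 r := Icc_subset_Icc_right hw.2.le
    exact ⟨(H.contP.mono hsub).intervalIntegrable_of_Icc hw.1.le,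
      (H.contQ.mono hsub).intervalIntegrable_of_Icc hw.1.le⟩
  obtain ⟨r, H | H⟩ := X.exists_comparableDensities hn hk
  · obtain ⟨r', hr0, hrr, horb⟩ := LienardFamily.exists_forall_isDensityOrbit hn hnk H
    have H' := H.mono hr0 hrr
    -- The section 0 < y < r'^(2n) corresponds to 0 < ω(y) < r'. The densities are restricted to [0,
    -- r'] so that existence and uniqueness hold inside this same section.
    have hδ : 0 < r' ^ (2 * n) := pow_pos hr0 _
    have hiff := fun (y₀ : ℝ) (y : ℕ → ℝ) =>
      X.isEntryExitOrbit_iff_of_lt (y₀ := y₀) (y := y) hδ fun t ht => by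
        have hw := LienardFamily.omegaPt_mem hn hr0.le ht
        have := H'.integral_lt_integral ⟨hw.1, hw.2.le⟩
        rw [X.JMinus_eq, X.JPlus_eq]
        linarith
    refine ⟨r' ^ (2 * n), hδ, fun t ht => X.intervalIntegrable_slowDivIntegrand
      (hint H' ht).1 (hint H' ht).2, fun y₀ hy₀ => ?_⟩
    simp only [hiff]
    refine ⟨LienardFamily.existsUnique_isDensityOrbit hn H' hy₀, fun y hy => ?_⟩
    obtain ⟨h1, h2, h3, h4, h5, h6, h7⟩ := horb y₀ y hy
    exact ⟨h1, h2, h3, h4, h5, hdim1, h6, h7, hdim2⟩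
  · obtain ⟨r', hr0, hrr, horb⟩ := LienardFamily.exists_forall_isDensityOrbit hn hnk H
    have H' := H.mono hr0 hrr
    have hδ : 0 < r' ^ (2 * n) := pow_pos hr0 _
    have hiff := fun (y₀ : ℝ) (y : ℕ → ℝ) =>
      X.isEntryExitOrbit_iff_of_gt (y₀ := y₀) (y := y) hδ fun t ht => by
        have hw := LienardFamily.omegaPt_mem hn hr0.le ht
        have := H'.integral_lt_integral ⟨hw.1, hw.2.le⟩
        rw [X.JMinus_eq, X.JPlus_eq]
        linarith
    refine ⟨r' ^ (2 * n), hδ, fun t ht => X.intervalIntegrable_slowDivIntegrand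
      (hint H' ht).2 (hint H' ht).1, fun y₀ hy₀ => ?_⟩
    simp only [hiff]
    refine ⟨LienardFamily.existsUnique_isDensityOrbit hn H' hy₀, fun y hy => ?_⟩
    obtain ⟨h1, h2, h3, h4, h5, h6, h7⟩ := horb y₀ y hy
    exact ⟨h1, h2, h3, h4, h5, hdim1, h6, h7, hdim2⟩
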